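/- Let $\mathcal X$ be an arbitrary set and $\mathcal H$ a finite-dimensional complex Hilbert space, let $\mathcal S(\mathcal H)$ be the set of density operators on $\mathcal H$ (positive semidefinite operators of trace one), and let $C(\mathcal H|\mathcal X)$ be the set of all maps $W:\mathcal X\to\mathcal S(\mathcal H)$ (classical-quantum channels). Write $\log$ for the natural logarithm, with $\log 0=-\infty$ and $\log(+\infty)=+\infty$; for a positive semidefinite operator $A$, $\widehat{\log}\,A$ denotes the logarithm taken on the support of $A$ and equal to $0$ on the kernel of $A$. For positive semidefinite $\varrho,\sigma$ let $D(\varrho\|\sigma)=\operatorname{Tr}\varrho(\widehat{\log}\,\varrho-\widehat{\log}\,\sigma)$ if $\operatorname{supp}\varrho\subseteq\operatorname{supp}\sigma$, and $D(\varrho\|\sigma)=+\infty$ otherwise. For density operators $\varrho,\sigma$ and $\alpha>1$ let $$Q_\alpha^\flat(\varrho\|\sigma)=\lim_{\varepsilon\searrow0}\operatorname{Tr}\exp\bigl(\alpha\log(\varrho+\varepsilon I)+(1-\alpha)\log(\sigma+\varepsilon I)\bigr)\in[0,+\infty],\qquad D_\alpha^\flat(\varrho\|\sigma)=\frac1{\alpha-1}\log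 Q_\alpha^\flat(\varrho\|\sigma).$$ For a finitely supported probability distribution $P$ on $\mathcal X$ and $V,W\in C(\mathcal H|\mathcal X)$ let $$D(V\|W|P)=\sum_{x\in\operatorname{supp}P}P(x)\,D(V(x)\|W(x)),\qquad \chi(V,P)=\inf_{\sigma\in\mathcal S(\mathcal H)}D\Bigl(\sum_{x}P(x)|x\rangle\langle x|\otimes V(x)\,\Big\|\,\sum_{x}P(x)|x\rangle\langle x|\otimes\sigma\Bigr),$$ $$\chi^\flat_{\alpha,2}(W,P)=\inf_{\sigma\in\mathcal S(\mathcal H)}\sum_{x\in\operatorname{supp}P}P(x)\,D_\alpha^\flat(W(x)\|\sigma),$$ where the sums in $\chi(V,P)$ run over $x\in\operatorname{supp}P$ and $\{|x\rangle\}_{x\in\operatorname{supp}P}$ is the standard orthonormal basis of the auxiliary space $\ell^2(\operatorname{supp}P)$. For $R\ge0$ define $$F(P,R,W)=\inf_{V\in C(\mathcal H|\mathcal X)}\bigl\{D(V\|W|P)+\max\{0,\,R-\chi(V,P)\}\bigr\}.$$ **Theorem.** For every $W\in C(\mathcal H|\mathcal X)$, every $R\ge0$ and every finitely supported probability distribution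 $P$ on $\mathcal X$, $$F(P,R,W)=\sup_{\alpha>1}\frac{\alpha-1}{\alpha}\bigl\{R-\chi^\flat_{\alpha,2}(W,P)\bigr\}.$$ -/

import Mathlib

open Filter Topology
open scoped ENNReal TensorProduct

noncomputable section

namespace CQ

section Operators

variable {H : Type*} [NormedAddCommGroup H] [InnerProductSpace ℂ H] [CompleteSpace H]

/-- The real part of the trace of an operator (it is the trace itself for the operators on a
finite-dimensional Hilbert space that occur below, whose traces are real). -/
def tr (A : H →L[ℂ] H) : ℝ := (LinearMap.trace ℂ H (A : H →ₗ[ℂ] H)).re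

variable (H) in
/-- The density operators on `H`: positive semidefinite operators of trace one. -/
def states : Set (H →L[ℂ] H) := {ρ | ρ.IsPositive ∧ LinearMap.trace ℂ H (ρ : H →ₗ[ℂ] H) = 1}

open Classical in
/-- Umegaki's relative entropy `D(ρ‖σ) = Tr ρ (log ρ - log σ)` if `supp ρ ≤ supp σ`, and `+∞`
otherwise. The logarithm `CFC.log` is the functional calculus of `Real.log`, which sends `0`
to `0`, so that logarithms are taken on the support. -/
def relEntropy (ρ σ : H →L[ℂ] H) : EReal :=
  if LinearMap.range (ρ : H →ₗ[ℂ] H) ≤ LinearMap.range (σ : H →ₗ[ℂ] H) then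
    ((tr (ρ * (CFC.log ρ - CFC.log σ)) : ℝ) : EReal)
  else ⊤

/-- `Tr exp (α log ρ + (1 - α) log σ)`, for positive definite `ρ` and `σ`. -/
def qFlatPos (α : ℝ) (ρ σ : H →L[ℂ] H) : ℝ :=
  tr (NormedSpace.exp (α • CFC.log ρ + (1 - α) • CFC.log σ))

/-- `Q_α^♭(ρ‖σ)` for positive semidefinite `ρ` and `σ`: the limit of the positive definite
expression at `ρ + ε I`, `σ + ε I` as `ε ↘ 0`, with values in `[0, +∞]`. -/
def qFlat (α : ℝ) (ρ σ : H →L[ℂ] H) : ℝ≥0∞ :=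
  limUnder (𝓝[>] (0 : ℝ)) fun ε : ℝ =>
    ENNReal.ofReal (qFlatPos α (ρ + ε • (1 : H →L[ℂ] H)) (σ + ε • (1 : H →L[ℂ] H)))

/-- The Rényi divergence `D_α^♭(ρ‖σ) = (log Q_α^♭(ρ‖σ) - log Tr ρ) / (α - 1)`,
for `α > 0`, `α ≠ 1`, where `log 0 = -∞` and `log (+∞) = +∞`. -/
def dFlat (α : ℝ) (ρ σ : H →L[ℂ] H) : EReal :=
  (((α - 1)⁻¹ : ℝ) : EReal) * ENNReal.log (qFlat α ρ σ)
    - (((α - 1)⁻¹ * Real.log (tr ρ) : ℝ) : EReal)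

end Operators

/-- Finitely supported probability distributions on `X`. -/
abbrev FinProb (X : Type*) := Convexity.StdSimplex ℝ X

/-- Classical-quantum channels with input alphabet `X` and output Hilbert space `H`. -/
abbrev Channel (X H : Type*) [NormedAddCommGroup H] [InnerProductSpace ℂ H] := X → states H

/-- A finite-dimensional tensor product of Hilbert spaces is a Hilbert space. -/
instance instCompleteSpaceTensor {K H : Type*} [NormedAddCommGroup K] [InnerProductSpace ℂ K]
    [FiniteDimensional ℂ K] [NormedAddCommGroup H] [InnerProductSpace ℂ H]
    [FiniteDimensional ℂ H] : CompleteSpace (K ⊗[ℂ] H) :=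
  FiniteDimensional.complete ℂ (K ⊗[ℂ] H)

section Channels

variable {X H : Type*} [NormedAddCommGroup H] [InnerProductSpace ℂ H]

/-- The auxiliary Hilbert space of a finitely supported distribution `P`, with orthonormal basis
`|x⟩` indexed by the points `x` of the support of `P`. -/
abbrev AuxSpace (P : FinProb X) := EuclideanSpace ℂ P.weights.support

open Classical in
/-- The projection `|x⟩⟨x|`. -/
def ketBra (P : FinProb X) (x : P.weights.support) : AuxSpace P →L[ℂ] AuxSpace P :=
  InnerProductSpace.rankOne ℂ (EuclideanSpace.single x (1 : ℂ)) (EuclideanSpace.single x (1 : ℂ))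

/-- The distribution `P` as the diagonal operator `∑ x, P(x) |x⟩⟨x|`. -/
def diagOp (P : FinProb X) : AuxSpace P →L[ℂ] AuxSpace P :=
  ∑ x : P.weights.support, (P.weights (x : X) : ℂ) • ketBra P x

/-- The classical-quantum state `∑ x, P(x) |x⟩⟨x| ⊗ W(x)`. -/
def liftedState (W : Channel X H) (P : FinProb X) :
    (AuxSpace P ⊗[ℂ] H) →L[ℂ] (AuxSpace P ⊗[ℂ] H) :=
  ∑ x : P.weights.support,
    (P.weights (x : X) : ℂ) • TensorProduct.mapL (ketBra P x) (W (x : X) : H →L[ℂ] H)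

/-- The Holevo quantity `χ(W, P) = inf_σ D(∑ x, P(x) |x⟩⟨x| ⊗ W(x) ‖ P ⊗ σ)`, the infimum being
over the density operators `σ` on `H`. -/
def holevo [FiniteDimensional ℂ H] (W : Channel X H) (P : FinProb X) : EReal :=
  ⨅ σ : states H,
    relEntropy (liftedState W P) (TensorProduct.mapL (diagOp P) (σ : H →L[ℂ] H))

/-- The generalized Holevo quantity
`χ_{α,2}^♭(W, P) = inf_σ ∑ x, P(x) D_α^♭(W(x)‖σ)`. -/
def chiFlatTwo [CompleteSpace H] (α : ℝ) (W : Channel X H) (P : FinProb X) : EReal :=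
  ⨅ σ : states H,
    ∑ x ∈ P.weights.support, (P.weights x : EReal) * dFlat α (W x : H →L[ℂ] H) (σ : H →L[ℂ] H)

/-- The conditional relative entropy `D(V‖W|P) = ∑ x, P(x) D(V(x)‖W(x))`. -/
def condRelEntropy [CompleteSpace H] (V W : Channel X H) (P : FinProb X) : EReal :=
  ∑ x ∈ P.weights.support,
    (P.weights x : EReal) * relEntropy (V x : H →L[ℂ] H) (W x : H →L[ℂ] H)

/-- `F(P, R, W) = inf_V { D(V‖W|P) + |R - χ(V, P)|^+ }`, the infimum being over all channels `V`
with the same input alphabet and output space as `W`. -/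
def exponentF [CompleteSpace H] [FiniteDimensional ℂ H]
    (P : FinProb X) (R : ℝ) (W : Channel X H) : EReal :=
  ⨅ V : Channel X H, condRelEntropy V W P + max 0 ((R : EReal) - holevo V P)

end Channels

end CQ

end

/-!
The identity is a Lagrangian duality. For `0 < s < 1` and `α = 1 / (1 - s)`, so that
`s = (α - 1) / α`, the positive part is `max 0 y = sup_s s * y`, and the Holevo quantity is
`χ(V, P) = inf_σ ∑ x, P(x) D(V(x)‖σ)`. Hence `F(P, R, W)` is the upper value of the game with payoff

  `∑ x, P(x) (D(V(x)‖W(x)) - s D(V(x)‖σ)) + s R`,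

where the first player minimizes over `V` and the second maximizes over the pairs `(s, σ)`. Once the
two values of the game are exchanged, the minimization over `V` is done separately for each `x`, and
the variational formula (`exists_dFlat_eq`)

  `D_α^♭(ρ‖σ) = max_τ {D(τ‖σ) - α / (α - 1) D(τ‖ρ)}`

turns the lower value into the right-hand side.

Three ingredients carry the proof.

* The variational formula. Before the limit `ε ↘ 0` it is the Gibbs variational principle
  (`tr_mul_add_ent_le`, `tr_gibbs_mul_add_ent`), a consequence of Klein's inequality
  (`tr_sub_tr_le_rel`). If the supports of `ρ` and `σ` are nested, the exponent is, up to a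
  Lipschitz term, increasing in `ε` when tested against states
  (`exists_tr_mul_flatExponent_le`), and the limit is exchanged with the maximum by
  compactness of the set of states. If they are not nested, the divergence is infinite
  (`dFlat_eq_top`).
* The Holevo quantity (`holevo_eq_chi`). The operators on the tensor product are block diagonal, and
  the functional calculus acts on each block, so the relative entropy there is an average of
  relative entropies on `H`; Donald's identity (`sum_rel_eq`) then shows that the average state
  is optimal.
* The minimax theorem (`iInf_iSup_lagrangian`). The payoff is convex in `V` since the entropy enters
  it with the coefficient `s - 1 < 0`. The pairs `(s, σ)` with `σ` positive definite are encoded by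
  the operators `T = s • σ`, that is by positive definite operators of trace less than one; in this
  variable the term `s Tr τ log σ` is the perspective of `σ ↦ Tr τ log σ`, and is concave because
  the logarithm is operator concave. The set of families `V` supported in the outputs of `W` is
  convex and compact, so that Sion's theorem applies.

The inequality between the two sides that does not need the minimax theorem is proved directly for
all states `σ`, singular ones included (`mul_sub_chiFlatTwo_le`).
-/

set_option linter.unusedSectionVars false

noncomputable section

namespace CQ

variable {H : Type*} [NormedAddCommGroup H] [InnerProductSpace ℂ H] [CompleteSpace H]
  [FiniteDimensional ℂ H]

/-! ### Spectral calculus and the trace -/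

lemma finite_spectrum_real (A : H →L[ℂ] H) : (spectrum ℝ A).Finite := by
  have h1 : (spectrum ℂ A).Finite := by
    have := Module.End.finite_spectrum (A : H →ₗ[ℂ] H)
    rwa [← AlgEquiv.spectrum_eq (Module.End.toContinuousLinearMap (𝕜 := ℂ) H)
      (A : H →ₗ[ℂ] H)] at this
  rw [← spectrum.preimage_algebraMap ℂ]
  exact h1.preimage (RCLike.ofReal_injective.injOn)

/-- In finite dimension the spectrum is finite, so every function is continuous on it. The
functional calculus of a self-adjoint operator therefore never takes its default value. -/
lemma continuousOn_spectrum (A : H →L[ℂ] H) (f : ℝ → ℝ) : ContinuousOn f (spectrum ℝ A) := by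
  have := (finite_spectrum_real A).isDiscrete.to_subtype
  exact continuousOn_iff_continuous_domRestrict.mpr continuous_of_discreteTopology

/-- The functional calculus acts on eigenvectors through the eigenvalues. -/
lemma cfc_apply_eigenvector {A : H →L[ℂ] H} (hA : IsSelfAdjoint A) {u : H} {r : ℝ}
    (hu : A u = (r : ℂ) • u) (f : ℝ → ℝ) : cfc f A u = (f r : ℂ) • u := by
  by_cases hu0 : u = 0
  · simp [hu0]
  have hr : r ∈ spectrum ℝ A := by
    rw [spectrum.mem_iff]
    intro hun
    obtain ⟨g, hg⟩ := hun.exists_left_inv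
    have : (g * ((algebraMap ℝ (H →L[ℂ] H)) r - A)) u = u := by rw [hg]; rfl
    apply hu0
    rw [← this]
    simp [hu, Algebra.algebraMap_eq_smul_one]
  -- on the finite spectrum `f` agrees with an interpolation polynomial, so `cfc f A` is a
  -- polynomial in `A`
  classical
  set s := (finite_spectrum_real A).toFinset
  set p := Lagrange.interpolate s id f
  have hp : ∀ x ∈ spectrum ℝ A, p.eval x = f x := fun x hx =>
    Lagrange.eval_interpolate_at_node (v := id) f Function.injective_id.injOn
      (by simpa [s] using hx)
  have h1 : cfc f A = Polynomial.aeval A p := by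
    rw [← cfc_polynomial p A hA]
    exact cfc_congr fun x hx => (hp x hx).symm
  have hpow : ∀ n : ℕ, (A ^ n) u = ((r ^ n : ℝ) : ℂ) • u := by
    intro n
    induction n with
    | zero => simp
    | succ n ih =>
      rw [pow_succ', mul_apply_eq_comp, ih, map_smul, hu, smul_smul]
      push_cast
      ring_nf
  have h2 : ∀ q : Polynomial ℝ, Polynomial.aeval A q u = ((q.eval r : ℝ) : ℂ) • u := by
    intro q
    induction q using Polynomial.induction_on' with
    | add p q hp hq => simp [hp, hq, add_smul]
    | monomial n a =>
      simp [Polynomial.aeval_monomial, hpow, Algebra.algebraMap_eq_smul_one, mul_smul]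
  rw [h1, h2, hp r hr]

lemma exists_eigenbasis {A : H →L[ℂ] H} (hA : IsSelfAdjoint A) :
    ∃ (u : OrthonormalBasis (Fin (Module.finrank ℂ H)) ℂ H) (a : Fin (Module.finrank ℂ H) → ℝ),
      ∀ i, A (u i) = (a i : ℂ) • u i := by
  have hS := ContinuousLinearMap.isSelfAdjoint_iff_isSymmetric.mp hA
  exact ⟨hS.eigenvectorBasis rfl, hS.eigenvalues rfl, fun i => hS.apply_eigenvectorBasis rfl i⟩

lemma tr_eq_sum {ι : Type*} [Fintype ι] (u : OrthonormalBasis ι ℂ H) (A : H →L[ℂ] H) :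
    tr A = ∑ i, (inner ℂ (u i) (A (u i))).re := by
  rw [tr, LinearMap.trace_eq_sum_inner _ u]
  simp

lemma tr_add (A B : H →L[ℂ] H) : tr (A + B) = tr A + tr B := by simp [tr]
lemma tr_sub (A B : H →L[ℂ] H) : tr (A - B) = tr A - tr B := by simp [tr]
lemma tr_zero : tr (0 : H →L[ℂ] H) = 0 := by simp [tr]
lemma tr_neg (A : H →L[ℂ] H) : tr (-A) = - tr A := by simp [tr]
lemma tr_smul (r : ℝ) (A : H →L[ℂ] H) : tr (r • A) = r * tr A := by
  have : ((r • A : H →L[ℂ] H) : H →ₗ[ℂ] H) = (r : ℂ) • (A : H →ₗ[ℂ] H) := by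
    ext; simp
  simp [tr, this]
lemma tr_sum {ι : Type*} (s : Finset ι) (A : ι → H →L[ℂ] H) :
    tr (∑ i ∈ s, A i) = ∑ i ∈ s, tr (A i) := by
  classical
  induction s using Finset.induction_on with
  | empty => simp [tr_zero]
  | insert a s ha ih => simp [Finset.sum_insert ha, tr_add, ih]

variable (H) in
/-- The real trace as a continuous real-linear functional. -/
def trL : (H →L[ℂ] H) →L[ℝ] ℝ :=
  LinearMap.toContinuousLinearMap
    { toFun := tr, map_add' := tr_add, map_smul' := fun r A => by simp [tr_smul] }

@[simp] lemma trL_apply (A : H →L[ℂ] H) : trL H A = tr A := rfl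

lemma continuous_tr : Continuous (tr : (H →L[ℂ] H) → ℝ) := (trL H).continuous

lemma continuous_tr_mul (A : H →L[ℂ] H) : Continuous fun τ => tr (τ * A) :=
  continuous_tr.comp (continuous_id.mul continuous_const)

/-- The trace of a product with a function of `B`, in an eigenbasis of `B`. -/
lemma tr_mul_cfc {ι : Type*} [Fintype ι] {B : H →L[ℂ] H} (hB : IsSelfAdjoint B)
    (v : OrthonormalBasis ι ℂ H) (b : ι → ℝ) (hv : ∀ j, B (v j) = (b j : ℂ) • v j)
    (A : H →L[ℂ] H) (g : ℝ → ℝ) :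
    tr (A * cfc g B) = ∑ j, g (b j) * (inner ℂ (v j) (A (v j))).re := by
  rw [tr_eq_sum v]
  refine Finset.sum_congr rfl fun j _ => ?_
  rw [mul_apply_eq_comp, cfc_apply_eigenvector hB (hv j)]
  simp

/-- The quadratic form of `f A` in an eigenbasis of `A`. -/
lemma inner_cfc_apply {ι : Type*} [Fintype ι] {A : H →L[ℂ] H} (hA : IsSelfAdjoint A)
    (u : OrthonormalBasis ι ℂ H) (a : ι → ℝ) (hu : ∀ i, A (u i) = (a i : ℂ) • u i)
    (f : ℝ → ℝ) (x : H) :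
    (inner ℂ x (cfc f A x)).re = ∑ i, f (a i) * ‖inner ℂ (u i) x‖ ^ 2 := by
  conv_lhs => rw [← u.sum_repr' x, map_sum, inner_sum]
  rw [Complex.re_sum]
  rw [u.sum_repr' x]
  refine Finset.sum_congr rfl fun i _ => ?_
  rw [map_smul, cfc_apply_eigenvector hA (hu i), inner_smul_right, inner_smul_right]
  rw [mul_left_comm, Complex.re_ofReal_mul, ← inner_conj_symm x (u i), Complex.mul_conj,
    Complex.ofReal_re, Complex.normSq_eq_norm_sq]

/-! ### Supports and Klein's inequality -/

lemma tr_cfc {ι : Type*} [Fintype ι] {B : H →L[ℂ] H} (hB : IsSelfAdjoint B)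
    (v : OrthonormalBasis ι ℂ H) (b : ι → ℝ) (hv : ∀ j, B (v j) = (b j : ℂ) • v j)
    (g : ℝ → ℝ) : tr (cfc g B) = ∑ j, g (b j) := by
  have := tr_mul_cfc hB v b hv 1 g
  simpa using this

/-- The trace `Tr f(A) g(B)` as a double sum over eigenbases, with the doubly stochastic weights
`‖⟪u i, v j⟫‖ ^ 2`. It reduces trace inequalities to inequalities between real numbers. -/
lemma tr_cfc_mul_cfc {ι κ : Type*} [Fintype ι] [Fintype κ] {A B : H →L[ℂ] H}
    (hA : IsSelfAdjoint A) (hB : IsSelfAdjoint B)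
    (u : OrthonormalBasis ι ℂ H) (a : ι → ℝ) (hu : ∀ i, A (u i) = (a i : ℂ) • u i)
    (v : OrthonormalBasis κ ℂ H) (b : κ → ℝ) (hv : ∀ j, B (v j) = (b j : ℂ) • v j)
    (f g : ℝ → ℝ) :
    tr (cfc f A * cfc g B) = ∑ j, ∑ i, f (a i) * g (b j) * ‖inner ℂ (u i) (v j)‖ ^ 2 := by
  rw [tr_mul_cfc hB v b hv]
  refine Finset.sum_congr rfl fun j _ => ?_
  rw [inner_cfc_apply hA u a hu, Finset.mul_sum]
  exact Finset.sum_congr rfl fun i _ => by ring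

lemma ext_basis {ι : Type*} [Fintype ι] (v : OrthonormalBasis ι ℂ H) {A B : H →L[ℂ] H}
    (h : ∀ j, A (v j) = B (v j)) : A = B := by
  ext x
  rw [← v.sum_repr x, map_sum, map_sum]
  simp [h]

lemma eigenvalue_nonneg {A : H →L[ℂ] H} (hA : 0 ≤ A) {ι : Type*} [Fintype ι]
    {u : OrthonormalBasis ι ℂ H} {a : ι → ℝ} (hu : ∀ i, A (u i) = (a i : ℂ) • u i) (i : ι) :
    0 ≤ a i := by
  have := ((ContinuousLinearMap.nonneg_iff_isPositive A).mp hA).re_inner_nonneg_right (u i)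
  rw [hu i, inner_smul_right] at this
  simpa using this

lemma re_inner_nonneg {A : H →L[ℂ] H} (hA : 0 ≤ A) (x : H) : 0 ≤ (inner ℂ x (A x)).re :=
  ((ContinuousLinearMap.nonneg_iff_isPositive A).mp hA).re_inner_nonneg_right x

lemma nonneg_isSelfAdjoint {A : H →L[ℂ] H} (hA : 0 ≤ A) : IsSelfAdjoint A := .of_nonneg hA

lemma tr_mul_nonneg {A B : H →L[ℂ] H} (hA : 0 ≤ A) (hB : 0 ≤ B) : 0 ≤ tr (A * B) := by
  have hBs := nonneg_isSelfAdjoint hB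
  obtain ⟨v, b, hv⟩ := exists_eigenbasis hBs
  rw [← cfc_id ℝ B, tr_mul_cfc hBs v b hv]
  exact Finset.sum_nonneg fun j _ => mul_nonneg (eigenvalue_nonneg hB hv j) (re_inner_nonneg hA _)

lemma tr_mul_le_tr_mul {A B C : H →L[ℂ] H} (hA : 0 ≤ A) (hBC : B ≤ C) :
    tr (A * B) ≤ tr (A * C) := by
  have := tr_mul_nonneg hA (sub_nonneg.mpr hBC)
  rw [mul_sub, tr_sub] at this
  linarith

/-- The orthogonal projection onto the kernel of a self-adjoint operator, as the functional
calculus of the indicator function of `{0}`. -/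
def kerProj (A : H →L[ℂ] H) : H →L[ℂ] H := cfc (fun x : ℝ => if x = 0 then 1 else 0) A

lemma kerProj_nonneg (A : H →L[ℂ] H) : 0 ≤ kerProj A :=
  cfc_nonneg fun x _ => by split_ifs <;> norm_num

lemma kerProj_apply_of_eq_zero {A : H →L[ℂ] H} (hA : IsSelfAdjoint A) {v : H} (h : A v = 0) :
    kerProj A v = v := by
  have := cfc_apply_eigenvector hA (u := v) (r := 0) (by simpa using h)
    (fun x : ℝ => if x = 0 then 1 else 0)
  simpa [kerProj] using this

lemma mul_kerProj (A : H →L[ℂ] H) (hA : IsSelfAdjoint A) : A * kerProj A = 0 := by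
  obtain ⟨v, b, hv⟩ := exists_eigenbasis hA
  refine ext_basis v fun j => ?_
  rw [mul_apply_eq_comp, kerProj, cfc_apply_eigenvector hA (hv j), map_smul, hv]
  by_cases h : b j = 0 <;> simp [h]

lemma range_le_of_mul_kerProj {A B : H →L[ℂ] H} (hA : IsSelfAdjoint A) (hB : IsSelfAdjoint B)
    (h : A * kerProj B = 0) :
    LinearMap.range (A : H →ₗ[ℂ] H) ≤ LinearMap.range (B : H →ₗ[ℂ] H) := by
  have h2 : kerProj B * A = 0 := by
    have := congrArg star h
    rwa [star_mul, hA.star_eq, (nonneg_isSelfAdjoint (kerProj_nonneg B)).star_eq, star_zero] at this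
  -- as `0⁻¹ = 0`, the functional calculus of the inverse is the inverse on the support
  have h3 : B * cfc (fun x : ℝ => x⁻¹) B + kerProj B = 1 := by
    obtain ⟨v, b, hv⟩ := exists_eigenbasis hB
    refine ext_basis v fun j => ?_
    rw [add_apply, mul_apply_eq_comp, kerProj,
      cfc_apply_eigenvector hB (hv j), cfc_apply_eigenvector hB (hv j), map_smul, hv, smul_smul]
    by_cases h : b j = 0
    · simp [h]
    · rw [← Complex.ofReal_mul, inv_mul_cancel₀ h]
      simp [h]
  have h4 : A = B * (cfc (fun x : ℝ => x⁻¹) B * A) := by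
    have := congrArg (· * A) h3
    simp only [add_mul, h2, one_mul, add_zero] at this
    rw [← mul_assoc, this]
  rintro _ ⟨x, rfl⟩
  refine ⟨(cfc (fun x : ℝ => x⁻¹) B * A) x, ?_⟩
  conv_rhs => rw [h4]
  rfl

lemma apply_eq_zero_of_range_le {A B : H →L[ℂ] H} (hA : IsSelfAdjoint A) (hB : IsSelfAdjoint B)
    (h : LinearMap.range (A : H →ₗ[ℂ] H) ≤ LinearMap.range (B : H →ₗ[ℂ] H)) {v : H}
    (hv : B v = 0) : A v = 0 := by
  have hAs := ContinuousLinearMap.isSelfAdjoint_iff_isSymmetric.mp hA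
  have hBs := ContinuousLinearMap.isSelfAdjoint_iff_isSymmetric.mp hB
  obtain ⟨y, hy⟩ := h ⟨A v, rfl⟩
  rw [← inner_self_eq_zero (𝕜 := ℂ)]
  have h1 : inner ℂ (A v) (A v) = inner ℂ v (A (A v)) := hAs v (A v)
  have h2 : inner ℂ (B v) y = inner ℂ v (B y) := hBs v y
  rw [h1]
  have h3 : A (A v) = B y := hy.symm
  rw [h3, ← h2, hv, inner_zero_left]

/-- Inclusion of supports, expressed through the projection onto the kernel. -/
lemma range_le_iff_mul_kerProj {A B : H →L[ℂ] H} (hA : IsSelfAdjoint A) (hB : IsSelfAdjoint B) :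
    LinearMap.range (A : H →ₗ[ℂ] H) ≤ LinearMap.range (B : H →ₗ[ℂ] H) ↔ A * kerProj B = 0 := by
  refine ⟨fun h => ?_, range_le_of_mul_kerProj hA hB⟩
  ext x
  rw [mul_apply_eq_comp]
  refine apply_eq_zero_of_range_le hA hB h ?_
  rw [← mul_apply_eq_comp, mul_kerProj B hB]
  rfl

lemma apply_eq_zero_of_re_inner_eq_zero {A : H →L[ℂ] H} (hA : 0 ≤ A) {x : H}
    (h : (inner ℂ x (A x)).re = 0) : A x = 0 := by
  have hs := nonneg_isSelfAdjoint hA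
  obtain ⟨u, a, hu⟩ := exists_eigenbasis hs
  have h1 := inner_cfc_apply hs u a hu id x
  simp only [id] at h1
  rw [cfc_id ℝ A, h, eq_comm, Finset.sum_eq_zero_iff_of_nonneg
    fun i _ => mul_nonneg (eigenvalue_nonneg hA hu i) (sq_nonneg _)] at h1
  rw [← u.sum_repr' x, map_sum]
  refine Finset.sum_eq_zero fun i _ => ?_
  rw [map_smul, hu]
  rcases mul_eq_zero.mp (h1 i (Finset.mem_univ i)) with h | h
  · have : a i = 0 := h
    simp [this]
  · have : inner ℂ (u i) x = 0 := by simpa using h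
    simp [this]

/-- For positive operators inclusion of supports is the vanishing of `Tr A (1 - supp B)`. -/
lemma range_le_iff_tr_mul_kerProj {A B : H →L[ℂ] H} (hA : 0 ≤ A) (hB : 0 ≤ B) :
    LinearMap.range (A : H →ₗ[ℂ] H) ≤ LinearMap.range (B : H →ₗ[ℂ] H) ↔
      tr (A * kerProj B) = 0 := by
  have hBs := nonneg_isSelfAdjoint hB
  rw [range_le_iff_mul_kerProj (nonneg_isSelfAdjoint hA) hBs]
  refine ⟨fun h => by rw [h, tr_zero], fun h => ?_⟩
  obtain ⟨v, b, hv⟩ := exists_eigenbasis hBs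
  have h1 := tr_mul_cfc hBs v b hv A (fun x : ℝ => if x = 0 then 1 else 0)
  rw [← kerProj, h, eq_comm, Finset.sum_eq_zero_iff_of_nonneg fun i _ => mul_nonneg
    (by split_ifs <;> norm_num) (re_inner_nonneg hA _)] at h1
  refine ext_basis v fun j => ?_
  rw [mul_apply_eq_comp, kerProj, cfc_apply_eigenvector hBs (hv j), map_smul]
  by_cases hb : b j = 0
  · have := h1 j (Finset.mem_univ j)
    rw [if_pos hb, one_mul] at this
    rw [apply_eq_zero_of_re_inner_eq_zero hA this]
    simp
  · simp [hb]

/-- If the support of `ρ` is contained in that of `σ`, then `ker σ ≤ ker ρ`, and the projection onto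
`ker σ` is below that onto `ker ρ`. -/
lemma tr_mul_kerProj_le {ρ σ τ : H →L[ℂ] H} (hρ : 0 ≤ ρ) (hσ : 0 ≤ σ) (hτ : 0 ≤ τ)
    (h : LinearMap.range (ρ : H →ₗ[ℂ] H) ≤ LinearMap.range (σ : H →ₗ[ℂ] H)) :
    tr (τ * kerProj σ) ≤ tr (τ * kerProj ρ) := by
  have hσs := nonneg_isSelfAdjoint hσ
  have hρs := nonneg_isSelfAdjoint hρ
  refine tr_mul_le_tr_mul hτ ?_
  have hsa := fun A : H →L[ℂ] H => nonneg_isSelfAdjoint (kerProj_nonneg A)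
  have h1 : kerProj ρ * kerProj σ = kerProj σ := by
    ext x
    rw [mul_apply_eq_comp]
    refine kerProj_apply_of_eq_zero hρs (apply_eq_zero_of_range_le hρs hσs h ?_)
    rw [← mul_apply_eq_comp, mul_kerProj σ hσs]
    rfl
  have h2 : kerProj σ * kerProj ρ = kerProj σ := by
    have := congrArg star h1
    rwa [star_mul, (hsa ρ).star_eq, (hsa σ).star_eq] at this
  have hid : ∀ A : H →L[ℂ] H, IsSelfAdjoint A → kerProj A * kerProj A = kerProj A := by
    intro A hA
    ext x
    rw [mul_apply_eq_comp]
    refine kerProj_apply_of_eq_zero hA ?_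
    rw [← mul_apply_eq_comp, mul_kerProj A hA]
    rfl
  -- the difference of nested projections is a projection, hence of the form `D† D`
  have h3 : kerProj ρ - kerProj σ = star (kerProj ρ - kerProj σ) * (kerProj ρ - kerProj σ) := by
    rw [star_sub, (hsa ρ).star_eq, (hsa σ).star_eq, sub_mul, mul_sub, mul_sub, h1, h2, hid ρ hρs,
      hid σ hσs]
    abel
  rw [← sub_nonneg, h3]
  exact star_mul_self_nonneg _

/-- The von Neumann entropy `-Tr τ log τ`. -/
def ent (τ : H →L[ℂ] H) : ℝ := - tr (τ * CFC.log τ)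

/-- The real number `Tr τ (log τ - log ω)`, the relative entropy if the support of `τ` is
contained in that of `ω`. -/
def rel (τ ω : H →L[ℂ] H) : ℝ := tr (τ * (CFC.log τ - CFC.log ω))

lemma rel_eq (τ ω : H →L[ℂ] H) : rel τ ω = - ent τ - tr (τ * CFC.log ω) := by
  rw [rel, ent, mul_sub, tr_sub]; ring

lemma rel_self (τ : H →L[ℂ] H) : rel τ τ = 0 := by simp [rel, tr_zero]

/-- Klein's inequality. -/
theorem tr_sub_tr_le_rel {τ ω : H →L[ℂ] H} (hτ : 0 ≤ τ) (hω : 0 ≤ ω)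
    (h : LinearMap.range (τ : H →ₗ[ℂ] H) ≤ LinearMap.range (ω : H →ₗ[ℂ] H)) :
    tr τ - tr ω ≤ rel τ ω := by
  have hτs := nonneg_isSelfAdjoint hτ
  have hωs := nonneg_isSelfAdjoint hω
  obtain ⟨u, t, hu⟩ := exists_eigenbasis hτs
  obtain ⟨v, w, hv⟩ := exists_eigenbasis hωs
  have key := fun f g => tr_cfc_mul_cfc hτs hωs u t hu v w hv f g
  have e1 : tr τ = ∑ j, ∑ i, t i * ‖inner ℂ (u i) (v j)‖ ^ 2 := by
    have := key id (fun _ => 1)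
    rw [cfc_id ℝ τ, cfc_const_one ℝ ω, mul_one] at this
    simpa using this
  have e2 : tr ω = ∑ j, ∑ i, w j * ‖inner ℂ (u i) (v j)‖ ^ 2 := by
    have := key (fun _ => 1) id
    rw [cfc_id ℝ ω, cfc_const_one ℝ τ, one_mul] at this
    simpa using this
  have e3 : tr (τ * CFC.log τ) = ∑ j, ∑ i, t i * Real.log (t i) * ‖inner ℂ (u i) (v j)‖ ^ 2 := by
    have := key (fun x => x * Real.log x) (fun _ => 1)
    rw [cfc_const_one ℝ ω, mul_one, cfc_mul _ _ _ (continuousOn_spectrum _ _)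
      (continuousOn_spectrum _ _), cfc_id' ℝ τ] at this
    simpa [CFC.log] using this
  have e4 : tr (τ * CFC.log ω) = ∑ j, ∑ i, t i * Real.log (w j) * ‖inner ℂ (u i) (v j)‖ ^ 2 := by
    have := key id Real.log
    rwa [cfc_id ℝ τ] at this
  rw [rel, mul_sub, tr_sub, e1, e2, e3, e4]
  simp only [← Finset.sum_sub_distrib]
  refine Finset.sum_le_sum fun j _ => Finset.sum_le_sum fun i _ => ?_
  simp only [← sub_mul]
  have hti := eigenvalue_nonneg hτ hu i
  rcases (eigenvalue_nonneg hω hv j).eq_or_lt with hw | hw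
  · -- a vector in the kernel of `ω` is in the kernel of `τ`
    have h0 : τ (v j) = 0 := apply_eq_zero_of_range_le hτs hωs h (by rw [hv, ← hw]; simp)
    have h1 : (inner ℂ (v j) (τ (v j))).re = ∑ i, t i * ‖inner ℂ (u i) (v j)‖ ^ 2 := by
      have := inner_cfc_apply hτs u t hu id (v j)
      rwa [cfc_id ℝ τ] at this
    rw [h0, inner_zero_right, Complex.zero_re, eq_comm, Finset.sum_eq_zero_iff_of_nonneg
      fun i _ => mul_nonneg (eigenvalue_nonneg hτ hu i) (sq_nonneg _)] at h1
    rcases mul_eq_zero.mp (h1 i (Finset.mem_univ i)) with h | h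
    · simp [h, ← hw]
    · simp [h]
  · refine mul_le_mul_of_nonneg_right ?_ (sq_nonneg _)
    rcases hti.eq_or_lt with ht | ht
    · simp [← ht, hw.le]
    · have := Real.log_le_sub_one_of_pos (div_pos hw ht)
      rw [Real.log_div hw.ne' ht.ne'] at this
      have h2 := mul_le_mul_of_nonneg_left this ht.le
      have h3 : t i * (w j / t i - 1) = w j - t i := by field_simp
      rw [h3] at h2
      linarith

/-- The trace of a positive operator is real, so the condition on the trace may be stated for its
real part. -/
lemma mem_states_iff {ρ : H →L[ℂ] H} : ρ ∈ states H ↔ 0 ≤ ρ ∧ tr ρ = 1 := by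
  rw [states, Set.mem_ofPred_eq, ContinuousLinearMap.nonneg_iff_isPositive]
  refine and_congr_right fun h => ⟨fun h1 => by simp [tr, h1], fun h1 => ?_⟩
  refine Complex.ext h1 ?_
  rw [LinearMap.trace_eq_sum_inner _ (stdOrthonormalBasis ℂ H), Complex.im_sum]
  refine Finset.sum_eq_zero fun i _ => ?_
  have := h.inner_nonneg_right
    (stdOrthonormalBasis ℂ H i)
  exact (Complex.nonneg_iff.mp this).2.symm

/-! ### States, entropy and the Gibbs variational principle -/

lemma states_nonneg {ρ : H →L[ℂ] H} (h : ρ ∈ states H) : 0 ≤ ρ := (mem_states_iff.mp h).1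
lemma states_tr {ρ : H →L[ℂ] H} (h : ρ ∈ states H) : tr ρ = 1 := (mem_states_iff.mp h).2

lemma convex_states : Convex ℝ (states H) := by
  intro ρ hρ σ hσ a b ha hb hab
  rw [mem_states_iff] at *
  refine ⟨add_nonneg (smul_nonneg ha hρ.1) (smul_nonneg hb hσ.1), ?_⟩
  rw [tr_add, tr_smul, tr_smul, hρ.2, hσ.2]
  linarith

lemma norm_le_one_of_mem_states {ρ : H →L[ℂ] H} (h : ρ ∈ states H) : ‖ρ‖ ≤ 1 := by
  have h0 := states_nonneg h
  have hs := nonneg_isSelfAdjoint h0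
  obtain ⟨u, a, hu⟩ := exists_eigenbasis hs
  have hsum : ∑ i, a i = 1 := by
    have := tr_cfc hs u a hu id
    rw [cfc_id ℝ ρ, states_tr h] at this
    exact this.symm
  have hle : ∀ i, a i ≤ 1 := fun i => hsum ▸
    Finset.single_le_sum (fun i _ => eigenvalue_nonneg h0 hu i) (Finset.mem_univ i)
  refine ContinuousLinearMap.opNorm_le_bound _ zero_le_one fun x => ?_
  rw [one_mul, ← sq_le_sq₀ (norm_nonneg _) (norm_nonneg _), ← u.sum_sq_norm_inner_right (ρ x),
    ← u.sum_sq_norm_inner_right x]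
  refine Finset.sum_le_sum fun i _ => ?_
  have h1 : inner ℂ (u i) (ρ x) = a i * inner ℂ (u i) x := by
    have : inner ℂ (ρ (u i)) x = inner ℂ (u i) (ρ x) :=
      (ContinuousLinearMap.isSelfAdjoint_iff_isSymmetric.mp hs) (u i) x
    rw [← this, hu, inner_smul_left]
    simp
  have h2 := eigenvalue_nonneg h0 hu i
  rw [h1, norm_mul, mul_pow, Complex.norm_real, Real.norm_of_nonneg h2]
  exact mul_le_of_le_one_left (sq_nonneg _) (pow_le_one₀ h2 (hle i))

lemma isClosed_states : IsClosed (states H) := by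
  have : states H = {ρ : H →L[ℂ] H | 0 ≤ ρ} ∩ {ρ | tr ρ = 1} := by
    ext ρ; exact mem_states_iff
  rw [this]
  exact (isClosed_le continuous_const continuous_id).inter
    (isClosed_eq continuous_tr continuous_const)

lemma isCompact_states : IsCompact (states H) := by
  have : ProperSpace (H →L[ℂ] H) := FiniteDimensional.proper ℂ _
  refine Metric.isCompact_of_isClosed_isBounded isClosed_states ?_
  exact (Metric.isBounded_closedBall (x := (0 : H →L[ℂ] H)) (r := 1)).subset fun ρ h => by
    simpa using norm_le_one_of_mem_states h

lemma ent_eq_tr_cfc {τ : H →L[ℂ] H} (hτ : IsSelfAdjoint τ) : ent τ = tr (cfc Real.negMulLog τ) := by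
  have : cfc Real.negMulLog τ = - (τ * CFC.log τ) := by
    simp only [Real.negMulLog_eq_neg]
    rw [cfc_neg, cfc_mul _ _ _ (continuousOn_spectrum _ _) (continuousOn_spectrum _ _),
      cfc_id' ℝ τ, CFC.log]
  rw [this, tr_neg, ent]

lemma continuousOn_ent : ContinuousOn (ent : (H →L[ℂ] H) → ℝ) {τ | 0 ≤ τ} := by
  have : ContinuousOn (fun τ : H →L[ℂ] H => cfc Real.negMulLog τ) {τ | 0 ≤ τ} :=
    ContinuousOn.cfc_of_mem_nhdsSet (s := Set.univ) _ Filter.univ_mem continuousOn_id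
      (fun τ hτ => nonneg_isSelfAdjoint hτ) Real.continuous_negMulLog.continuousOn
  exact (continuous_tr.comp_continuousOn this).congr fun τ hτ =>
    ent_eq_tr_cfc (nonneg_isSelfAdjoint hτ)

lemma range_le_add_left {ρ σ : H →L[ℂ] H} (hρ : 0 ≤ ρ) (hσ : 0 ≤ σ) :
    LinearMap.range (ρ : H →ₗ[ℂ] H) ≤ LinearMap.range ((ρ + σ : H →L[ℂ] H) : H →ₗ[ℂ] H) := by
  have h := add_nonneg hρ hσ
  have hs := nonneg_isSelfAdjoint h
  rw [range_le_iff_tr_mul_kerProj hρ h]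
  have h1 : tr ((ρ + σ) * kerProj (ρ + σ)) = 0 := by rw [mul_kerProj _ hs, tr_zero]
  rw [add_mul, tr_add] at h1
  have h2 := tr_mul_nonneg hρ (kerProj_nonneg (ρ + σ))
  have h3 := tr_mul_nonneg hσ (kerProj_nonneg (ρ + σ))
  linarith

lemma range_smul_eq {ρ : H →L[ℂ] H} {r : ℝ} (hr : r ≠ 0) :
    LinearMap.range ((r • ρ : H →L[ℂ] H) : H →ₗ[ℂ] H) = LinearMap.range (ρ : H →ₗ[ℂ] H) := by
  have : ((r • ρ : H →L[ℂ] H) : H →ₗ[ℂ] H) = (r : ℂ) • (ρ : H →ₗ[ℂ] H) := by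
    ext; simp
  rw [this, LinearMap.range_smul _ _ (by exact_mod_cast hr)]

/-- Concavity of the entropy: Klein's inequality is applied to each of the two states and their
mixture, whose support contains both supports. -/
lemma concaveOn_ent : ConcaveOn ℝ (states H) ent := by
  refine ⟨convex_states, fun ρ hρ σ hσ a b ha hb hab => ?_⟩
  rcases ha.eq_or_lt with rfl | ha
  · obtain rfl : b = 1 := by linarith
    simp
  rcases hb.eq_or_lt with rfl | hb
  · obtain rfl : a = 1 := by linarith
    simp
  have hω := convex_states hρ hσ ha.le hb.le hab
  have h0 := states_nonneg hρ
  have h1 := states_nonneg hσ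
  have hr1 : LinearMap.range (ρ : H →ₗ[ℂ] H) ≤
      LinearMap.range ((a • ρ + b • σ : H →L[ℂ] H) : H →ₗ[ℂ] H) := by
    have := range_le_add_left (smul_nonneg ha.le h0) (smul_nonneg hb.le h1)
    rwa [range_smul_eq ha.ne'] at this
  have hr2 : LinearMap.range (σ : H →ₗ[ℂ] H) ≤
      LinearMap.range ((a • ρ + b • σ : H →L[ℂ] H) : H →ₗ[ℂ] H) := by
    have := range_le_add_left (smul_nonneg hb.le h1) (smul_nonneg ha.le h0)
    rwa [range_smul_eq hb.ne', add_comm] at this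
  have k1 := tr_sub_tr_le_rel h0 (states_nonneg hω) hr1
  have k2 := tr_sub_tr_le_rel h1 (states_nonneg hω) hr2
  rw [states_tr hω, states_tr hρ, rel_eq] at k1
  rw [states_tr hω, states_tr hσ, rel_eq] at k2
  have k3 : ent (a • ρ + b • σ) = - (a * tr (ρ * CFC.log (a • ρ + b • σ))
      + b * tr (σ * CFC.log (a • ρ + b • σ))) := by
    rw [ent, add_mul, tr_add, smul_mul_assoc, smul_mul_assoc, tr_smul, tr_smul]
  rw [k3, smul_eq_mul, smul_eq_mul]
  nlinarith

lemma isStrictlyPositive_exp {K : H →L[ℂ] H} (hK : IsSelfAdjoint K) :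
    IsStrictlyPositive (NormedSpace.exp K) := by
  rw [← CFC.real_exp_eq_normedSpace_exp hK]
  refine ⟨cfc_nonneg fun x _ => (Real.exp_pos x).le, ?_⟩
  rw [isUnit_cfc_iff _ _ (continuousOn_spectrum _ _)]
  exact fun x _ => (Real.exp_pos x).ne'

lemma tr_exp_pos [Nontrivial H] {K : H →L[ℂ] H} (hK : IsSelfAdjoint K) :
    0 < tr (NormedSpace.exp K) := by
  obtain ⟨u, a, hu⟩ := exists_eigenbasis hK
  rw [← CFC.real_exp_eq_normedSpace_exp hK, tr_cfc hK u a hu]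
  have : NeZero (Module.finrank ℂ H) := ⟨Module.finrank_pos.ne'⟩
  exact Finset.sum_pos (fun i _ => Real.exp_pos _) Finset.univ_nonempty

lemma range_eq_top_of_isStrictlyPositive {A : H →L[ℂ] H} (hA : IsStrictlyPositive A) :
    LinearMap.range (A : H →ₗ[ℂ] H) = ⊤ := by
  rw [LinearMap.range_eq_top]
  obtain ⟨g, hg⟩ := hA.isUnit.exists_right_inv
  intro x
  refine ⟨g x, ?_⟩
  change (A * g) x = x
  rw [hg]; rfl

lemma nontrivial_of_states (h : (states H).Nonempty) : Nontrivial H := by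
  by_contra hn
  rw [not_nontrivial_iff_subsingleton] at hn
  obtain ⟨ρ, hρ⟩ := h
  have : ρ = 0 := Subsingleton.elim _ _
  have h1 := states_tr hρ
  rw [this, tr_zero] at h1
  exact zero_ne_one h1

/-- The Gibbs state `exp K / Tr exp K`. -/
def gibbs (K : H →L[ℂ] H) : H →L[ℂ] H := (tr (NormedSpace.exp K))⁻¹ • NormedSpace.exp K

lemma gibbs_mem_states [Nontrivial H] {K : H →L[ℂ] H} (hK : IsSelfAdjoint K) :
    gibbs K ∈ states H := by
  have h := tr_exp_pos hK
  rw [mem_states_iff, gibbs]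
  refine ⟨smul_nonneg (inv_nonneg.mpr h.le) (isStrictlyPositive_exp hK).nonneg, ?_⟩
  rw [tr_smul, inv_mul_cancel₀ h.ne']

/-- The relative entropy with respect to the Gibbs state. -/
lemma rel_gibbs [Nontrivial H] {K τ : H →L[ℂ] H} (hK : IsSelfAdjoint K) (hτ : τ ∈ states H) :
    rel τ (gibbs K) = Real.log (tr (NormedSpace.exp K)) - (tr (τ * K) + ent τ) := by
  have h := tr_exp_pos hK
  rw [rel_eq, gibbs, CFC.log_smul' _ (inv_pos.mpr h) (isStrictlyPositive_exp hK),
    CFC.log_exp K hK, mul_add, tr_add, Algebra.algebraMap_eq_smul_one, mul_smul_comm, mul_one,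
    tr_smul, states_tr hτ, Real.log_inv]
  ring

/-- The Gibbs variational principle, upper bound. -/
lemma tr_mul_add_ent_le [Nontrivial H] {K τ : H →L[ℂ] H} (hK : IsSelfAdjoint K)
    (hτ : τ ∈ states H) : tr (τ * K) + ent τ ≤ Real.log (tr (NormedSpace.exp K)) := by
  have h := gibbs_mem_states hK
  have hp : IsStrictlyPositive (gibbs K) :=
    .smul (inv_pos.mpr (tr_exp_pos hK)) (isStrictlyPositive_exp hK)
  have := tr_sub_tr_le_rel (states_nonneg hτ) (states_nonneg h)
    (by rw [range_eq_top_of_isStrictlyPositive hp]; exact le_top)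
  rw [rel_gibbs hK hτ, states_tr hτ, states_tr h] at this
  linarith

/-- The Gibbs variational principle: the bound is attained at the Gibbs state. -/
lemma tr_gibbs_mul_add_ent [Nontrivial H] {K : H →L[ℂ] H} (hK : IsSelfAdjoint K) :
    tr (gibbs K * K) + ent (gibbs K) = Real.log (tr (NormedSpace.exp K)) := by
  have := rel_gibbs hK (gibbs_mem_states hK)
  rw [rel_self] at this
  linarith

/-! ### The variational formula for the divergence -/

lemma log_add_smul_one {ρ : H →L[ℂ] H} (hρ : IsSelfAdjoint ρ) (ε : ℝ) :
    CFC.log (ρ + ε • (1 : H →L[ℂ] H)) = cfc (fun x => Real.log (x + ε)) ρ := by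
  obtain ⟨v, r, hv⟩ := exists_eigenbasis hρ
  have hs : IsSelfAdjoint (ρ + ε • (1 : H →L[ℂ] H)) :=
    hρ.add ((IsSelfAdjoint.all ε).smul (IsSelfAdjoint.one _))
  refine ext_basis v fun j => ?_
  have h : (ρ + ε • (1 : H →L[ℂ] H)) (v j) = ((r j + ε : ℝ) : ℂ) • v j := by
    rw [add_apply, hv]
    simp [add_smul]
  rw [CFC.log, cfc_apply_eigenvector hs h, cfc_apply_eigenvector hρ (hv j)]

/-- Regularizing the logarithm by `ε` adds `log ε` on the kernel, and converges on the support. -/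
lemma tendsto_tr_mul_log {ρ τ : H →L[ℂ] H} (hρ : 0 ≤ ρ) :
    Tendsto (fun ε : ℝ => tr (τ * CFC.log (ρ + ε • (1 : H →L[ℂ] H)))
      - tr (τ * kerProj ρ) * Real.log ε) (𝓝[>] 0) (𝓝 (tr (τ * CFC.log ρ))) := by
  have hρs := nonneg_isSelfAdjoint hρ
  obtain ⟨v, r, hv⟩ := exists_eigenbasis hρs
  simp only [log_add_smul_one hρs]
  simp only [kerProj, CFC.log, tr_mul_cfc hρs v r hv, Finset.sum_mul,
    ← Finset.sum_sub_distrib]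
  refine tendsto_finsetSum _ fun j _ => ?_
  rcases (eigenvalue_nonneg hρ hv j).eq_or_lt with h | h
  · simp only [← h, zero_add, if_true, one_mul, Real.log_zero, zero_mul]
    refine tendsto_const_nhds.congr fun ε => by ring
  · simp only [h.ne', if_false, zero_mul, sub_zero]
    refine Tendsto.mul_const _ (tendsto_nhdsWithin_of_tendsto_nhds ?_)
    have : Tendsto (fun ε : ℝ => r j + ε) (𝓝 0) (𝓝 (r j)) := by
      simpa using (tendsto_const_nhds (x := r j)).add (tendsto_id (x := 𝓝 (0 : ℝ)))
    exact this.log h.ne'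

/-- The growth in `ε` of the regularized logarithm is at least its growth on the kernel. -/
lemma tr_mul_log_sub_ge {ρ τ : H →L[ℂ] H} (hρ : 0 ≤ ρ) (hτ : 0 ≤ τ) {ε δ : ℝ} (hε : 0 < ε)
    (hδ : ε ≤ δ) : tr (τ * kerProj ρ) * (Real.log δ - Real.log ε) ≤
      tr (τ * CFC.log (ρ + δ • (1 : H →L[ℂ] H))) - tr (τ * CFC.log (ρ + ε • (1 : H →L[ℂ] H))) := by
  have hρs := nonneg_isSelfAdjoint hρ
  obtain ⟨v, r, hv⟩ := exists_eigenbasis hρs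
  simp only [log_add_smul_one hρs, kerProj, tr_mul_cfc hρs v r hv, Finset.sum_mul,
    ← Finset.sum_sub_distrib, ← sub_mul]
  refine Finset.sum_le_sum fun j _ => ?_
  have hq := re_inner_nonneg hτ (v j)
  have hr := eigenvalue_nonneg hρ hv j
  rw [mul_right_comm]
  refine mul_le_mul_of_nonneg_right ?_ hq
  split_ifs with h
  · simp [h]
  · rw [zero_mul, sub_nonneg]
    exact Real.log_le_log (by linarith) (by linarith)

/-- The growth in `ε` of the regularized logarithm exceeds its growth on the kernel by at most a
Lipschitz term, uniformly over the states. -/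
lemma exists_tr_mul_log_sub_le {σ : H →L[ℂ] H} (hσ : 0 ≤ σ) : ∃ C : ℝ, 0 ≤ C ∧
    ∀ τ ∈ states H, ∀ ε δ : ℝ, 0 < ε → ε ≤ δ →
      tr (τ * CFC.log (σ + δ • (1 : H →L[ℂ] H))) - tr (τ * CFC.log (σ + ε • (1 : H →L[ℂ] H))) ≤
        tr (τ * kerProj σ) * (Real.log δ - Real.log ε) + C * (δ - ε) := by
  have hσs := nonneg_isSelfAdjoint hσ
  obtain ⟨v, r, hv⟩ := exists_eigenbasis hσs
  have hr := eigenvalue_nonneg hσ hv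
  -- each nonzero eigenvalue `r` contributes at most `1 / r` to the slope; zero eigenvalues
  -- contribute nothing to the sum, as `0⁻¹ = 0`
  refine ⟨∑ j, (r j)⁻¹, Finset.sum_nonneg fun j _ => inv_nonneg.mpr (hr j), ?_⟩
  intro τ hτ ε δ hε hδ
  have hq := fun j => re_inner_nonneg (states_nonneg hτ) (v j)
  have hq1 : ∀ j, (inner ℂ (v j) (τ (v j))).re ≤ 1 := fun j => by
    rw [← states_tr hτ, tr_eq_sum v]
    exact Finset.single_le_sum (fun j _ => hq j) (Finset.mem_univ j)
  simp only [log_add_smul_one hσs, kerProj, tr_mul_cfc hσs v r hv, Finset.sum_mul,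
    ← Finset.sum_sub_distrib, ← Finset.sum_add_distrib, ← sub_mul]
  refine Finset.sum_le_sum fun j _ => ?_
  rcases (hr j).eq_or_lt with h | h
  · simp only [← h, zero_add, if_true, one_mul, inv_zero, zero_mul, add_zero]
    rw [mul_comm]
  · simp only [h.ne', if_false, zero_mul, zero_add]
    have h1 : Real.log (r j + δ) - Real.log (r j + ε) ≤ (r j)⁻¹ * (δ - ε) := by
      rw [← Real.log_div (by linarith) (by linarith)]
      refine (Real.log_le_sub_one_of_pos (div_pos (by linarith) (by linarith))).trans ?_
      rw [div_sub_one (by linarith), add_sub_add_left_eq_sub, div_eq_inv_mul]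
      refine mul_le_mul_of_nonneg_right ?_ (by linarith)
      exact inv_anti₀ h (by linarith)
    have h2 : 0 ≤ (r j)⁻¹ * (δ - ε) := mul_nonneg (inv_nonneg.mpr h.le) (by linarith)
    nlinarith [hq j, hq1 j]

/-- The exponent `α log (ρ + ε) + (1 - α) log (σ + ε)`. -/
def flatExponent (α : ℝ) (ρ σ : H →L[ℂ] H) (ε : ℝ) : H →L[ℂ] H :=
  α • CFC.log (ρ + ε • (1 : H →L[ℂ] H)) + (1 - α) • CFC.log (σ + ε • (1 : H →L[ℂ] H))

lemma isSelfAdjoint_flatExponent (α : ℝ) (ρ σ : H →L[ℂ] H) (ε : ℝ) :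
    IsSelfAdjoint (flatExponent α ρ σ ε) :=
  ((IsSelfAdjoint.all α).smul IsSelfAdjoint.log).add
    ((IsSelfAdjoint.all (1 - α)).smul IsSelfAdjoint.log)

lemma tr_mul_flatExponent (α : ℝ) (ρ σ τ : H →L[ℂ] H) (ε : ℝ) : tr (τ * flatExponent α ρ σ ε) =
    α * tr (τ * CFC.log (ρ + ε • (1 : H →L[ℂ] H)))
      + (1 - α) * tr (τ * CFC.log (σ + ε • (1 : H →L[ℂ] H))) := by
  rw [flatExponent, mul_add, tr_add, mul_smul_comm, mul_smul_comm, tr_smul, tr_smul]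

lemma qFlatPos_eq (α : ℝ) (ρ σ : H →L[ℂ] H) (ε : ℝ) :
    qFlatPos α (ρ + ε • (1 : H →L[ℂ] H)) (σ + ε • (1 : H →L[ℂ] H)) =
      tr (NormedSpace.exp (flatExponent α ρ σ ε)) := rfl

lemma tendsto_tr_mul_flatExponent {α : ℝ} {ρ σ τ : H →L[ℂ] H} (hρ : 0 ≤ ρ) (hσ : 0 ≤ σ) :
    Tendsto (fun ε => tr (τ * flatExponent α ρ σ ε)
      - (α * tr (τ * kerProj ρ) + (1 - α) * tr (τ * kerProj σ)) * Real.log ε) (𝓝[>] 0)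
      (𝓝 (α * tr (τ * CFC.log ρ) + (1 - α) * tr (τ * CFC.log σ))) := by
  refine (((tendsto_tr_mul_log hρ).const_mul α).add
    ((tendsto_tr_mul_log hσ).const_mul (1 - α))).congr fun ε => ?_
  rw [tr_mul_flatExponent]
  ring

lemma dFlat_of_tendsto_top {α : ℝ} (hα : 1 < α) {ρ σ : H →L[ℂ] H} (hρ : ρ ∈ states H)
    (h : Tendsto (fun ε => tr (NormedSpace.exp (flatExponent α ρ σ ε))) (𝓝[>] 0) atTop) :
    dFlat α ρ σ = ⊤ := by
  have h1 : qFlat α ρ σ = ⊤ := by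
    refine Tendsto.limUnder_eq ?_
    simp only [qFlatPos_eq]
    exact ENNReal.tendsto_ofReal_atTop.comp h
  rw [dFlat, h1, ENNReal.log_top, states_tr hρ, Real.log_one, mul_zero, EReal.coe_zero, sub_zero,
    EReal.coe_mul_top_of_pos (inv_pos.mpr (by linarith))]

lemma dFlat_of_tendsto [Nontrivial H] {α L : ℝ} {ρ σ : H →L[ℂ] H} (hρ : ρ ∈ states H)
    (h : Tendsto (fun ε => Real.log (tr (NormedSpace.exp (flatExponent α ρ σ ε)))) (𝓝[>] 0) (𝓝 L)) :
    dFlat α ρ σ = (((α - 1)⁻¹ * L : ℝ) : EReal) := by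
  have h1 : qFlat α ρ σ = ENNReal.ofReal (Real.exp L) := by
    refine Tendsto.limUnder_eq ?_
    simp only [qFlatPos_eq]
    refine (ENNReal.continuous_ofReal.comp Real.continuous_exp).continuousAt.tendsto.comp h
      |>.congr fun ε => ?_
    simp [Real.exp_log (tr_exp_pos (isSelfAdjoint_flatExponent α ρ σ ε))]
  rw [dFlat, h1, ENNReal.log_ofReal_of_pos (Real.exp_pos L), Real.log_exp, states_tr hρ,
    Real.log_one, mul_zero, EReal.coe_zero, sub_zero, EReal.coe_mul]

/-- The divergence is infinite if the supports are not nested: testing the variational principle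
with `τ = ρ` gives a lower bound of order `(α - 1) Tr (ρ (1 - supp σ)) log (1 / ε)`. -/
theorem dFlat_eq_top {α : ℝ} (hα : 1 < α) {ρ σ : H →L[ℂ] H} (hρ : ρ ∈ states H) (hσ : 0 ≤ σ)
    (h : ¬ LinearMap.range (ρ : H →ₗ[ℂ] H) ≤ LinearMap.range (σ : H →ₗ[ℂ] H)) :
    dFlat α ρ σ = ⊤ := by
  have := nontrivial_of_states ⟨ρ, hρ⟩
  have hρ0 := states_nonneg hρ
  refine dFlat_of_tendsto_top hα hρ ?_
  have ha : 0 < tr (ρ * kerProj σ) := lt_of_le_of_ne (tr_mul_nonneg hρ0 (kerProj_nonneg σ))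
    fun h0 => h ((range_le_iff_tr_mul_kerProj hρ0 hσ).mpr h0.symm)
  have h1 := tendsto_tr_mul_flatExponent (α := α) (τ := ρ) hρ0 hσ
  rw [mul_kerProj ρ (nonneg_isSelfAdjoint hρ0), tr_zero, mul_zero, zero_add] at h1
  have h2 : Tendsto (fun ε => (1 - α) * tr (ρ * kerProj σ) * Real.log ε) (𝓝[>] 0) atTop :=
    Real.tendsto_log_nhdsGT_zero.const_mul_atBot_of_neg
      (mul_neg_of_neg_of_pos (by linarith) ha)
  have h3 := (h1.add_atTop h2).atTop_add (tendsto_const_nhds (x := ent ρ))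
  refine tendsto_atTop_mono (fun ε => ?_) (Real.tendsto_exp_atTop.comp h3)
  have h4 := tr_mul_add_ent_le (isSelfAdjoint_flatExponent α ρ σ ε) hρ
  rw [Function.comp_apply,
    ← Real.le_log_iff_exp_le (tr_exp_pos (isSelfAdjoint_flatExponent α ρ σ ε))]
  linarith

/-- Tested against states, `flatExponent` is increasing in `ε` up to a Lipschitz term. On the
kernels the logarithms grow like `log ε`, with the coefficient
`α Tr τ (1 - supp ρ) - (α - 1) Tr τ (1 - supp σ)`; the inclusion of the supports makes it
nonnegative. -/
lemma exists_tr_mul_flatExponent_le {α : ℝ} (hα : 1 < α) {ρ σ : H →L[ℂ] H} (hρ : 0 ≤ ρ) (hσ : 0 ≤ σ)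
    (h : LinearMap.range (ρ : H →ₗ[ℂ] H) ≤ LinearMap.range (σ : H →ₗ[ℂ] H)) :
    ∃ C : ℝ, 0 ≤ C ∧ ∀ τ ∈ states H, ∀ ε δ : ℝ, 0 < ε → ε ≤ δ →
      tr (τ * flatExponent α ρ σ ε) + C * ε ≤ tr (τ * flatExponent α ρ σ δ) + C * δ := by
  obtain ⟨C, hC, hCs⟩ := exists_tr_mul_log_sub_le hσ
  refine ⟨(α - 1) * C, mul_nonneg (by linarith) hC, fun τ hτ ε δ hε hδ => ?_⟩
  have h0 := states_nonneg hτ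
  have h1 := tr_mul_log_sub_ge hρ h0 hε hδ
  have h2 := hCs τ hτ ε δ hε hδ
  have h3 := tr_mul_kerProj_le hρ hσ h0 h
  have h4 := tr_mul_nonneg h0 (kerProj_nonneg ρ)
  have h5 : 0 ≤ Real.log δ - Real.log ε := sub_nonneg.mpr (Real.log_le_log hε hδ)
  rw [tr_mul_flatExponent, tr_mul_flatExponent]
  have e1 := mul_le_mul_of_nonneg_left h1 (by linarith : (0 : ℝ) ≤ α)
  have e2 := mul_le_mul_of_nonneg_left h2 (by linarith : (0 : ℝ) ≤ α - 1)
  have e3 := mul_le_mul_of_nonneg_right h3 h5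
  have e4 := mul_le_mul_of_nonneg_left e3 (by linarith : (0 : ℝ) ≤ α - 1)
  have e5 := mul_nonneg h4 h5
  nlinarith

/-- The states whose support is contained in that of `ρ`. -/
def statesIn (ρ : H →L[ℂ] H) : Set (H →L[ℂ] H) :=
  {τ | τ ∈ states H ∧ LinearMap.range (τ : H →ₗ[ℂ] H) ≤ LinearMap.range (ρ : H →ₗ[ℂ] H)}

lemma statesIn_eq {ρ : H →L[ℂ] H} (hρ : 0 ≤ ρ) :
    statesIn ρ = states H ∩ {τ | tr (τ * kerProj ρ) = 0} := by
  ext τ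
  exact and_congr_right fun h => range_le_iff_tr_mul_kerProj (states_nonneg h) hρ

lemma isCompact_statesIn {ρ : H →L[ℂ] H} (hρ : 0 ≤ ρ) : IsCompact (statesIn ρ) := by
  rw [statesIn_eq hρ]
  exact isCompact_states.inter_right (isClosed_eq (continuous_tr_mul _) continuous_const)

lemma convex_statesIn {ρ : H →L[ℂ] H} (hρ : 0 ≤ ρ) : Convex ℝ (statesIn ρ) := by
  rw [statesIn_eq hρ]
  refine convex_states.inter fun τ hτ ω hω a b _ _ _ => ?_
  simp only [Set.mem_ofPred_eq] at *
  rw [add_mul, tr_add, smul_mul_assoc, smul_mul_assoc, tr_smul, tr_smul, hτ, hω]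
  simp

lemma self_mem_statesIn {ρ : H →L[ℂ] H} (hρ : ρ ∈ states H) : ρ ∈ statesIn ρ := ⟨hρ, le_rfl⟩

/-- If the supports are nested, the limit defining the divergence exists, is finite and is given
by the variational formula `max_τ {D(τ‖σ) - α / (α - 1) D(τ‖ρ)}`. -/
theorem exists_dFlat_eq {α : ℝ} (hα : 1 < α) {ρ σ : H →L[ℂ] H} (hρ : ρ ∈ states H) (hσ : 0 ≤ σ)
    (h : LinearMap.range (ρ : H →ₗ[ℂ] H) ≤ LinearMap.range (σ : H →ₗ[ℂ] H)) :
    ∃ L : ℝ, dFlat α ρ σ = L ∧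
      IsGreatest ((fun τ => rel τ σ - α / (α - 1) * rel τ ρ) '' statesIn ρ) L := by
  have := nontrivial_of_states ⟨ρ, hρ⟩
  have hρ0 := states_nonneg hρ
  have hα0 : α - 1 ≠ 0 := by linarith
  have hent : ContinuousOn (ent : (H →L[ℂ] H) → ℝ) (states H) :=
    continuousOn_ent.mono fun τ hτ => states_nonneg hτ
  set φ : (H →L[ℂ] H) → ℝ := fun τ =>
    α * tr (τ * CFC.log ρ) + (1 - α) * tr (τ * CFC.log σ) + ent τ with hφ
  have hφrel : ∀ τ, (α - 1)⁻¹ * φ τ = rel τ σ - α / (α - 1) * rel τ ρ := by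
    intro τ
    rw [rel_eq, rel_eq, hφ]
    field_simp
    ring
  have hφc : ContinuousOn φ (statesIn ρ) :=
    ((((continuous_tr_mul _).const_mul _).add
      ((continuous_tr_mul _).const_mul _)).continuousOn).add (hent.mono fun τ hτ => hτ.1)
  obtain ⟨τ₀, hτ₀, hmax⟩ := (isCompact_statesIn hρ0).exists_isMaxOn
    ⟨ρ, self_mem_statesIn hρ⟩ hφc
  have hlim : ∀ τ ∈ statesIn ρ, Tendsto (fun ε => tr (τ * flatExponent α ρ σ ε) + ent τ) (𝓝[>] 0)
      (𝓝 (φ τ)) := by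
    intro τ hτ
    have h0 := states_nonneg hτ.1
    have h1 := (range_le_iff_tr_mul_kerProj h0 hρ0).mp hτ.2
    have h2 := (range_le_iff_tr_mul_kerProj h0 hσ).mp (hτ.2.trans h)
    have := (tendsto_tr_mul_flatExponent (α := α) (τ := τ) hρ0 hσ).add_const (ent τ)
    simpa [h1, h2] using this
  refine ⟨(α - 1)⁻¹ * φ τ₀, dFlat_of_tendsto hρ ?_, ?_⟩
  swap
  · refine ⟨⟨τ₀, hτ₀, (hφrel τ₀).symm⟩, ?_⟩
    rintro _ ⟨τ, hτ, rfl⟩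
    simp only [← hφrel]
    exact mul_le_mul_of_nonneg_left (hmax hτ) (inv_nonneg.mpr (by linarith))
  obtain ⟨C, hC, hmono⟩ := exists_tr_mul_flatExponent_le hα hρ0 hσ h
  refine tendsto_order.mpr ⟨fun c hc => ?_, fun c hc => ?_⟩
  · filter_upwards [(hlim τ₀ hτ₀).eventually_const_lt hc] with ε hε
    exact hε.trans_le (tr_mul_add_ent_le (isSelfAdjoint_flatExponent α ρ σ ε) hτ₀.1)
  -- it suffices to find one `δ` at which the increasing function is below `c`
  suffices ∃ δ > 0, Real.log (tr (NormedSpace.exp (flatExponent α ρ σ δ))) + C * δ < c by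
    obtain ⟨δ, hδ, hδc⟩ := this
    filter_upwards [Ioc_mem_nhdsGT hδ] with ε hε
    have hK := isSelfAdjoint_flatExponent α ρ σ ε
    have h1 := hmono _ (gibbs_mem_states hK) ε δ hε.1 hε.2
    have h2 := tr_mul_add_ent_le (isSelfAdjoint_flatExponent α ρ σ δ) (gibbs_mem_states hK)
    have h3 := tr_gibbs_mul_add_ent hK
    have h4 := mul_nonneg hC hε.1.le
    linarith
  by_contra! hcon
  -- otherwise the sets `S δ` are nonempty, compact and nested; a common point contradicts `hmax`
  set S : Set.Ioi (0 : ℝ) → Set (H →L[ℂ] H) := fun δ =>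
    {τ ∈ states H | c ≤ tr (τ * flatExponent α ρ σ δ) + ent τ + C * δ} with hS
  have hSne : ∀ δ, (S δ).Nonempty := fun δ => by
    have hK := isSelfAdjoint_flatExponent α ρ σ δ
    refine ⟨_, gibbs_mem_states hK, ?_⟩
    rw [tr_gibbs_mul_add_ent hK]
    exact hcon δ δ.2
  have hSc : ∀ δ, IsCompact (S δ) := fun δ => by
    have : ContinuousOn (fun τ => tr (τ * flatExponent α ρ σ δ) + ent τ + C * δ) (states H) :=
      ((continuous_tr_mul _).continuousOn.add hent).add continuousOn_const
    have h1 := this.preimage_isClosed_of_isClosed isClosed_states (isClosed_Ici (a := c))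
    exact isCompact_states.of_isClosed_subset h1 Set.inter_subset_left
  have hSd : Directed (· ⊇ ·) S := by
    have hm : ∀ δ η : Set.Ioi (0 : ℝ), δ ≤ η → S δ ⊆ S η := fun δ η hle τ hτ =>
      ⟨hτ.1, hτ.2.trans (by have := hmono τ hτ.1 δ η δ.2 hle; linarith)⟩
    intro δ η
    exact ⟨min δ η, hm _ _ (min_le_left _ _), hm _ _ (min_le_right _ _)⟩
  have : Nonempty (Set.Ioi (0 : ℝ)) := ⟨1, Set.mem_Ioi.mpr one_pos⟩
  obtain ⟨τ, hτ⟩ := IsCompact.nonempty_iInter_of_directed_nonempty_isCompact_isClosed S hSd hSne hSc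
    fun δ => (hSc δ).isClosed
  rw [Set.mem_iInter] at hτ
  have hτs : τ ∈ states H := (hτ ⟨1, Set.mem_Ioi.mpr one_pos⟩).1
  have h0 := states_nonneg hτs
  have hge : ∀ᶠ ε in 𝓝[>] (0 : ℝ), c ≤ tr (τ * flatExponent α ρ σ ε) + ent τ + C * ε :=
    eventually_nhdsWithin_of_forall fun ε hε => (hτ ⟨ε, hε⟩).2
  have hCε : Tendsto (fun ε : ℝ => C * ε) (𝓝[>] 0) (𝓝 0) := by
    have : Tendsto (fun ε : ℝ => C * ε) (𝓝 0) (𝓝 (C * 0)) := tendsto_id.const_mul C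
    rw [mul_zero] at this
    exact tendsto_nhdsWithin_of_tendsto_nhds this
  -- outside the support of `ρ` the exponent tends to `-∞`
  have hτin : τ ∈ statesIn ρ := by
    refine ⟨hτs, (range_le_iff_tr_mul_kerProj h0 hρ0).mpr ?_⟩
    by_contra hne
    have hpos : 0 < tr (τ * kerProj ρ) :=
      lt_of_le_of_ne (tr_mul_nonneg h0 (kerProj_nonneg ρ)) (Ne.symm hne)
    have hle := tr_mul_kerProj_le hρ0 hσ h0 h
    have hco : 0 < α * tr (τ * kerProj ρ) + (1 - α) * tr (τ * kerProj σ) := by nlinarith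
    have h1 := (tendsto_tr_mul_flatExponent (α := α) (τ := τ) hρ0 hσ).add_atBot
      (Real.tendsto_log_nhdsGT_zero.const_mul_atBot hco)
    have h2 := (h1.atBot_add (tendsto_const_nhds (x := ent τ))).atBot_add hCε
    obtain ⟨ε, hε1, hε2⟩ := ((h2.eventually_lt_atBot c).and hge).exists
    linarith
  have h1 := ge_of_tendsto ((hlim τ hτin).add hCε) hge
  have h2 : φ τ ≤ φ τ₀ := hmax hτin
  linarith

/-! ### Block diagonal operators on the tensor product -/

variable {X : Type*} {P : FinProb X}

section BlockDiagonal

open scoped Classical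


lemma ketBra_single (x y : P.weights.support) :
    ketBra P x (EuclideanSpace.single y 1) = if x = y then EuclideanSpace.single y 1 else 0 := by
  rw [ketBra, InnerProductSpace.rankOne_apply]
  split_ifs with h
  · subst h; simp
  · have : inner ℂ (EuclideanSpace.single x (1 : ℂ)) (EuclideanSpace.single y (1 : ℂ)) = 0 := by
      rw [EuclideanSpace.inner_single_left]
      simp [h]
    rw [this, zero_smul]

/-- The block diagonal operator `∑ x, |x⟩⟨x| ⊗ A x`. -/
def block (P : FinProb X) (A : P.weights.support → H →L[ℂ] H) :
    (AuxSpace P ⊗[ℂ] H) →L[ℂ] (AuxSpace P ⊗[ℂ] H) :=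
  ∑ x, TensorProduct.mapL (ketBra P x) (A x)

lemma block_tmul (A : P.weights.support → H →L[ℂ] H) (x : P.weights.support) (h : H) :
    block P A (EuclideanSpace.single x 1 ⊗ₜ h) = EuclideanSpace.single x 1 ⊗ₜ A x h := by
  rw [block, sum_apply, Finset.sum_eq_single x]
  · rw [TensorProduct.mapL_tmul, ketBra_single, if_pos rfl]
  · intro y _ hy
    rw [TensorProduct.mapL_tmul, ketBra_single, if_neg hy, TensorProduct.zero_tmul]
  · simp

lemma block_ext {T S : (AuxSpace P ⊗[ℂ] H) →L[ℂ] (AuxSpace P ⊗[ℂ] H)}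
    (h : ∀ (x : P.weights.support) (v : H),
      T (EuclideanSpace.single x 1 ⊗ₜ v) = S (EuclideanSpace.single x 1 ⊗ₜ v)) : T = S := by
  rw [← ContinuousLinearMap.coe_inj]
  refine TensorProduct.ext ?_
  refine (EuclideanSpace.basisFun P.weights.support ℂ).toBasis.ext fun x => ?_
  ext v
  simpa using h x v

lemma block_mul (A B : P.weights.support → H →L[ℂ] H) :
    block P A * block P B = block P fun x => A x * B x :=
  block_ext fun x v => by simp only [mul_apply_eq_comp, block_tmul]

lemma block_sub (A B : P.weights.support → H →L[ℂ] H) :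
    block P A - block P B = block P fun x => A x - B x :=
  block_ext fun x v => by simp only [sub_apply, block_tmul, TensorProduct.tmul_sub]

lemma isSelfAdjoint_block {A : P.weights.support → H →L[ℂ] H} (hA : ∀ x, IsSelfAdjoint (A x)) :
    IsSelfAdjoint (block P A) := by
  unfold block
  refine isSelfAdjoint_sum (R := (AuxSpace P ⊗[ℂ] H) →L[ℂ] (AuxSpace P ⊗[ℂ] H)) _ fun x _ => ?_
  have h : IsSelfAdjoint (ketBra P x) := by
    rw [ketBra]
    exact (InnerProductSpace.isPositive_rankOne_self _).isSelfAdjoint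
  rw [ContinuousLinearMap.isSelfAdjoint_iff', TensorProduct.adjoint_mapL,
    ContinuousLinearMap.isSelfAdjoint_iff'.mp h, ContinuousLinearMap.isSelfAdjoint_iff'.mp (hA x)]

/-- The functional calculus of self-adjoint operators, stated for an arbitrary space in order to be
applied to the tensor product, where instance search does not find it. -/
theorem continuousFunctionalCalculus_clm (H : Type*) [NormedAddCommGroup H] [InnerProductSpace ℂ H]
    [CompleteSpace H] : ContinuousFunctionalCalculus ℝ (H →L[ℂ] H) IsSelfAdjoint := inferInstance

instance : ContinuousFunctionalCalculus ℝ ((AuxSpace P ⊗[ℂ] H) →L[ℂ] (AuxSpace P ⊗[ℂ] H))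
    IsSelfAdjoint := continuousFunctionalCalculus_clm _

/-- The functional calculus acts on each block: both sides agree on the product vectors `|x⟩ ⊗ u`
with `u` an eigenvector of the block `A x`. -/
lemma cfc_block {A : P.weights.support → H →L[ℂ] H} (hA : ∀ x, IsSelfAdjoint (A x)) (f : ℝ → ℝ) :
    cfc f (block P A) = block P fun x => cfc f (A x) := by
  refine block_ext fun x v => ?_
  obtain ⟨u, a, hu⟩ := exists_eigenbasis (hA x)
  rw [← u.sum_repr v]
  simp only [TensorProduct.tmul_sum, map_sum, TensorProduct.tmul_smul, map_smul]
  refine Finset.sum_congr rfl fun i _ => ?_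
  rw [cfc_apply_eigenvector (isSelfAdjoint_block hA) (r := a i) (by
    rw [block_tmul, hu, TensorProduct.tmul_smul]), block_tmul, cfc_apply_eigenvector (hA x) (hu i),
    TensorProduct.tmul_smul]

lemma trace_ketBra (x : P.weights.support) :
    LinearMap.trace ℂ (AuxSpace P) (ketBra P x : AuxSpace P →ₗ[ℂ] AuxSpace P) = 1 := by
  rw [LinearMap.trace_eq_sum_inner _ (EuclideanSpace.basisFun P.weights.support ℂ),
    Finset.sum_eq_single x]
  · simp [ketBra_single]
  · intro y _ hy
    simp [ketBra_single, hy.symm]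
  · simp

lemma tr_block (A : P.weights.support → H →L[ℂ] H) : tr (block P A) = ∑ x, tr (A x) := by
  rw [block, tr_sum]
  refine Finset.sum_congr rfl fun x _ => ?_
  rw [tr, TensorProduct.toLinearMap_mapL, LinearMap.trace_tensorProduct', trace_ketBra, one_mul, tr]

lemma block_eq_zero_iff (A : P.weights.support → H →L[ℂ] H) : block P A = 0 ↔ ∀ x, A x = 0 := by
  refine ⟨fun h x => ?_, fun h => ?_⟩
  · ext v
    have h1 := block_tmul A x v
    rw [h, zero_apply] at h1
    have h2 := congrArg norm h1
    rw [TensorProduct.norm_tmul] at h2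
    simpa using h2.symm
  · exact block_ext fun x v => by simp [block_tmul, h]

lemma range_block_le_iff {A B : P.weights.support → H →L[ℂ] H} (hA : ∀ x, IsSelfAdjoint (A x))
    (hB : ∀ x, IsSelfAdjoint (B x)) :
    LinearMap.range (block P A : (AuxSpace P ⊗[ℂ] H) →ₗ[ℂ] (AuxSpace P ⊗[ℂ] H)) ≤
      LinearMap.range (block P B : (AuxSpace P ⊗[ℂ] H) →ₗ[ℂ] (AuxSpace P ⊗[ℂ] H)) ↔
    ∀ x, LinearMap.range (A x : H →ₗ[ℂ] H) ≤ LinearMap.range (B x : H →ₗ[ℂ] H) := by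
  rw [range_le_iff_mul_kerProj (isSelfAdjoint_block hA) (isSelfAdjoint_block hB), kerProj,
    cfc_block hB, block_mul, block_eq_zero_iff]
  exact forall_congr' fun x => (range_le_iff_mul_kerProj (hA x) (hB x)).symm

/-- As the logarithm is `0` on the kernel, scaling shifts it on the support only. -/
lemma log_smul_eq {A : H →L[ℂ] H} (hA : IsSelfAdjoint A) {r : ℝ} (hr : r ≠ 0) :
    CFC.log (r • A) = CFC.log A + Real.log r • (1 - kerProj A) := by
  obtain ⟨v, a, hv⟩ := exists_eigenbasis hA
  refine ext_basis v fun j => ?_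
  have h : (r • A) (v j) = ((r * a j : ℝ) : ℂ) • v j := by
    rw [smul_apply, hv]
    push_cast
    rw [mul_smul]
    simp
  rw [CFC.log, cfc_apply_eigenvector ((IsSelfAdjoint.all r).smul hA) h, add_apply, CFC.log,
    cfc_apply_eigenvector hA (hv j), smul_apply, sub_apply, kerProj,
    cfc_apply_eigenvector hA (hv j)]
  by_cases ha : a j = 0
  · simp [ha]
  · rw [Real.log_mul hr ha]
    simp [ha, add_smul, add_comm]

/-- The relative entropy is homogeneous under a common scaling of both arguments. -/
lemma rel_smul_smul {A B : H →L[ℂ] H} (hA : IsSelfAdjoint A) (hB : IsSelfAdjoint B) {r : ℝ}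
    (hr : r ≠ 0) (h : LinearMap.range (A : H →ₗ[ℂ] H) ≤ LinearMap.range (B : H →ₗ[ℂ] H)) :
    rel (r • A) (r • B) = r * rel A B := by
  rw [rel, log_smul_eq hA hr, log_smul_eq hB hr, smul_mul_assoc, tr_smul, rel]
  congr 2
  simp only [mul_sub, mul_add, mul_smul_comm, mul_kerProj A hA,
    (range_le_iff_mul_kerProj hA hB).mp h]
  abel

lemma relEntropy_of_le {ρ σ : H →L[ℂ] H}
    (h : LinearMap.range (ρ : H →ₗ[ℂ] H) ≤ LinearMap.range (σ : H →ₗ[ℂ] H)) :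
    relEntropy ρ σ = rel ρ σ := by rw [relEntropy, if_pos h, rel]

lemma relEntropy_of_not_le {ρ σ : H →L[ℂ] H}
    (h : ¬ LinearMap.range (ρ : H →ₗ[ℂ] H) ≤ LinearMap.range (σ : H →ₗ[ℂ] H)) :
    relEntropy ρ σ = ⊤ := by rw [relEntropy, if_neg h]

lemma states_isSelfAdjoint (ρ : states H) : IsSelfAdjoint (ρ : H →L[ℂ] H) :=
  nonneg_isSelfAdjoint (states_nonneg ρ.2)

lemma weights_pos (P : FinProb X) {x : X} (hx : x ∈ P.weights.support) : 0 < P.weights x :=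
  lt_of_le_of_ne (P.nonneg x) (Finsupp.mem_support_iff.mp hx).symm

lemma sum_weights (P : FinProb X) : ∑ x ∈ P.weights.support, P.weights x = 1 := P.total

lemma relEntropy_lifted_eq (V : Channel X H) (σ : states H) :
    relEntropy (liftedState V P) (TensorProduct.mapL (diagOp P) (σ : H →L[ℂ] H)) =
      relEntropy (block P fun x => P.weights (x : X) • (V (x : X) : H →L[ℂ] H))
        (block P fun x => P.weights (x : X) • (σ : H →L[ℂ] H)) := by
  congr 1
  · rw [liftedState, block]
    refine Finset.sum_congr rfl fun x _ => ?_
    rw [← TensorProduct.mapL_smul_right]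
    rfl
  · refine block_ext fun x v => ?_
    rw [block_tmul, TensorProduct.mapL_tmul, diagOp, sum_apply,
      Finset.sum_eq_single x]
    · rw [smul_apply, ketBra_single, if_pos rfl, TensorProduct.smul_tmul]
      simp
    · intro y _ hy
      rw [smul_apply, ketBra_single, if_neg hy, smul_zero]
    · simp

/-- The relative entropy between `∑ x, P(x) |x⟩⟨x| ⊗ V(x)` and `P ⊗ σ` is the average of the
relative entropies `D(V(x)‖σ)`. -/
lemma relEntropy_lifted_of_le (V : Channel X H) (σ : states H)
    (h : ∀ x ∈ P.weights.support, LinearMap.range ((V x : H →L[ℂ] H) : H →ₗ[ℂ] H) ≤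
      LinearMap.range ((σ : H →L[ℂ] H) : H →ₗ[ℂ] H)) :
    relEntropy (liftedState V P) (TensorProduct.mapL (diagOp P) (σ : H →L[ℂ] H)) =
      ((∑ x ∈ P.weights.support, P.weights x * rel (V x : H →L[ℂ] H) σ : ℝ) : EReal) := by
  have hw : ∀ x : P.weights.support, P.weights (x : X) ≠ 0 := fun x => (weights_pos P x.2).ne'
  have hA : ∀ x : P.weights.support, IsSelfAdjoint (P.weights (x : X) • (V (x : X) : H →L[ℂ] H)) :=
    fun x => (IsSelfAdjoint.all _).smul (states_isSelfAdjoint _)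
  have hB : ∀ x : P.weights.support, IsSelfAdjoint (P.weights (x : X) • (σ : H →L[ℂ] H)) :=
    fun x => (IsSelfAdjoint.all _).smul (states_isSelfAdjoint _)
  rw [relEntropy_lifted_eq, relEntropy_of_le, rel, CFC.log, CFC.log, cfc_block hA, cfc_block hB,
    block_sub, block_mul, tr_block]
  · refine congrArg Real.toEReal ?_
    rw [← Finset.sum_coe_sort P.weights.support
      fun x => P.weights x * rel (V x : H →L[ℂ] H) (σ : H →L[ℂ] H)]
    refine Finset.sum_congr rfl fun x _ => ?_
    rw [← rel_smul_smul (states_isSelfAdjoint _) (states_isSelfAdjoint _) (hw x) (h x x.2)]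
    rfl
  · rw [range_block_le_iff hA hB]
    intro x
    rw [range_smul_eq (hw x), range_smul_eq (hw x)]
    exact h x x.2

lemma relEntropy_lifted_of_not_le (V : Channel X H) (σ : states H)
    (h : ¬ ∀ x ∈ P.weights.support, LinearMap.range ((V x : H →L[ℂ] H) : H →ₗ[ℂ] H) ≤
      LinearMap.range ((σ : H →L[ℂ] H) : H →ₗ[ℂ] H)) :
    relEntropy (liftedState V P) (TensorProduct.mapL (diagOp P) (σ : H →L[ℂ] H)) = ⊤ := by
  have hw : ∀ x : P.weights.support, P.weights (x : X) ≠ 0 := fun x => (weights_pos P x.2).ne'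
  rw [relEntropy_lifted_eq, relEntropy_of_not_le]
  rw [range_block_le_iff (fun x => (IsSelfAdjoint.all _).smul (states_isSelfAdjoint _))
    (fun x => (IsSelfAdjoint.all _).smul (states_isSelfAdjoint _))]
  intro hall
  refine h fun x hx => ?_
  have := hall ⟨x, hx⟩
  rwa [range_smul_eq (hw ⟨x, hx⟩), range_smul_eq (hw ⟨x, hx⟩)] at this

end BlockDiagonal

/-! ### The Holevo quantity and weak duality -/

lemma sum_ne_bot {ι : Type*} (s : Finset ι) (f : ι → EReal) (h : ∀ i ∈ s, f i ≠ ⊥) :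
    ∑ i ∈ s, f i ≠ ⊥ := by
  classical
  induction s using Finset.induction_on with
  | empty => simp
  | insert a s ha ih =>
    rw [Finset.sum_insert ha, ne_eq, EReal.add_eq_bot_iff, not_or]
    exact ⟨h a (Finset.mem_insert_self a s), ih fun i hi => h i (Finset.mem_insert_of_mem hi)⟩

lemma sum_eq_top {ι : Type*} (s : Finset ι) (f : ι → EReal) (h : ∀ i ∈ s, f i ≠ ⊥) {i : ι}
    (hi : i ∈ s) (hf : f i = ⊤) : ∑ i ∈ s, f i = ⊤ := by
  classical
  rw [← Finset.add_sum_erase s f hi, hf]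
  exact EReal.top_add_of_ne_bot (sum_ne_bot _ _ fun j hj => h j (Finset.mem_of_mem_erase hj))

lemma coe_sum {ι : Type*} (s : Finset ι) (f : ι → ℝ) :
    ((∑ i ∈ s, f i : ℝ) : EReal) = ∑ i ∈ s, (f i : EReal) := by
  classical
  induction s using Finset.induction_on with
  | empty => simp
  | insert a s ha ih => rw [Finset.sum_insert ha, Finset.sum_insert ha, EReal.coe_add, ih]

lemma sum_weights_mul_coe (P : FinProb X) {f : X → EReal} {g : X → ℝ}
    (h : ∀ x ∈ P.weights.support, f x = g x) :
    ∑ x ∈ P.weights.support, (P.weights x : EReal) * f x =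
      ((∑ x ∈ P.weights.support, P.weights x * g x : ℝ) : EReal) := by
  rw [coe_sum]
  exact Finset.sum_congr rfl fun x hx => by rw [h x hx, EReal.coe_mul]

lemma sum_weights_mul_eq_top (P : FinProb X) {f : X → EReal}
    (h : ∀ x ∈ P.weights.support, f x = ⊤ ∨ ∃ r : ℝ, f x = r) {x : X} (hx : x ∈ P.weights.support)
    (hf : f x = ⊤) : ∑ x ∈ P.weights.support, (P.weights x : EReal) * f x = ⊤ := by
  refine sum_eq_top _ _ (fun y hy => ?_) hx ?_
  · rcases h y hy with h | ⟨r, h⟩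
    · rw [h, EReal.coe_mul_top_of_pos (weights_pos P hy)]
      exact top_ne_bot
    · rw [h, ← EReal.coe_mul]
      exact EReal.coe_ne_bot _
  · rw [hf, EReal.coe_mul_top_of_pos (weights_pos P hx)]

/-- The support of every output of `V` on the support of `P` lies in that of the corresponding
operator of the family `B`. -/
def SuppLE (P : FinProb X) (V : Channel X H) (B : X → H →L[ℂ] H) : Prop :=
  ∀ x ∈ P.weights.support,
    LinearMap.range ((V x : H →L[ℂ] H) : H →ₗ[ℂ] H) ≤ LinearMap.range (B x : H →ₗ[ℂ] H)

lemma condRelEntropy_of_suppLE {V W : Channel X H} (h : SuppLE P V fun x => W x) :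
    condRelEntropy V W P =
      ((∑ x ∈ P.weights.support, P.weights x * rel (V x : H →L[ℂ] H) (W x) : ℝ) : EReal) :=
  sum_weights_mul_coe P fun x hx => relEntropy_of_le (h x hx)

lemma condRelEntropy_of_not_suppLE {V W : Channel X H} (h : ¬ SuppLE P V fun x => W x) :
    condRelEntropy V W P = ⊤ := by
  unfold SuppLE at h
  push Not at h
  obtain ⟨x, hx, hxn⟩ := h
  refine sum_weights_mul_eq_top P (fun y _ => ?_) hx (relEntropy_of_not_le hxn)
  by_cases hy : LinearMap.range ((V y : H →L[ℂ] H) : H →ₗ[ℂ] H) ≤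
      LinearMap.range ((W y : H →L[ℂ] H) : H →ₗ[ℂ] H)
  · exact .inr ⟨_, relEntropy_of_le hy⟩
  · exact .inl (relEntropy_of_not_le hy)

/-- The average output state of a channel. -/
def meanState (V : Channel X H) (P : FinProb X) : H →L[ℂ] H :=
  ∑ x ∈ P.weights.support, P.weights x • (V x : H →L[ℂ] H)

lemma meanState_mem (V : Channel X H) (P : FinProb X) : meanState V P ∈ states H :=
  convex_states.sum_mem (fun x _ => P.nonneg x) (sum_weights P) fun x _ => (V x).2

lemma suppLE_meanState (V : Channel X H) (P : FinProb X) :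
    SuppLE P V fun _ => meanState V P := by
  classical
  intro x hx
  have h0 : ∀ y ∈ P.weights.support, 0 ≤ P.weights y • (V y : H →L[ℂ] H) :=
    fun y hy => smul_nonneg (weights_pos P hy).le (states_nonneg (V y).2)
  have := range_le_add_left (h0 x hx) (Finset.sum_nonneg fun y hy =>
    h0 y (Finset.mem_of_mem_erase (a := x) hy))
  rw [Finset.add_sum_erase _ (fun y => P.weights y • (V y : H →L[ℂ] H)) hx,
    range_smul_eq (weights_pos P hx).ne'] at this
  exact this

lemma meanState_range_le {V : Channel X H} {σ : H →L[ℂ] H} (hσ : 0 ≤ σ)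
    (h : SuppLE P V fun _ => σ) :
    LinearMap.range (meanState V P : H →ₗ[ℂ] H) ≤ LinearMap.range (σ : H →ₗ[ℂ] H) := by
  have hs := nonneg_isSelfAdjoint hσ
  rw [range_le_iff_mul_kerProj (nonneg_isSelfAdjoint (states_nonneg (meanState_mem V P))) hs,
    meanState, Finset.sum_mul]
  refine Finset.sum_eq_zero fun x hx => ?_
  rw [smul_mul_assoc, (range_le_iff_mul_kerProj (states_isSelfAdjoint _) hs).mp (h x hx), smul_zero]

/-- The entropic expression of the Holevo quantity. -/
def chi (V : Channel X H) (P : FinProb X) : ℝ :=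
  ent (meanState V P) - ∑ x ∈ P.weights.support, P.weights x * ent (V x : H →L[ℂ] H)

/-- Donald's identity: the average relative entropy to `σ` exceeds `chi` by the relative entropy of
the average state. -/
lemma sum_rel_eq (V : Channel X H) (P : FinProb X) (σ : H →L[ℂ] H) :
    ∑ x ∈ P.weights.support, P.weights x * rel (V x : H →L[ℂ] H) σ =
      chi V P + rel (meanState V P) σ := by
  have h : tr (meanState V P * CFC.log σ) =
      ∑ x ∈ P.weights.support, P.weights x * tr ((V x : H →L[ℂ] H) * CFC.log σ) := by
    rw [meanState, Finset.sum_mul, tr_sum]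
    exact Finset.sum_congr rfl fun x _ => by rw [smul_mul_assoc, tr_smul]
  rw [rel_eq, chi, h]
  simp only [rel_eq, mul_sub, mul_neg, Finset.sum_sub_distrib, Finset.sum_neg_distrib]
  ring

lemma rel_meanState_nonneg {V : Channel X H} {σ : H →L[ℂ] H} (hσ : σ ∈ states H)
    (h : SuppLE P V fun _ => σ) : 0 ≤ rel (meanState V P) σ := by
  have hm := meanState_mem V P
  have := tr_sub_tr_le_rel (states_nonneg hm) (states_nonneg hσ)
    (meanState_range_le (states_nonneg hσ) h)
  rwa [states_tr hm, states_tr hσ, sub_self] at this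

/-- The infimum defining the Holevo quantity is attained at the average state. -/
theorem holevo_eq_chi (V : Channel X H) (P : FinProb X) : holevo V P = chi V P := by
  refine le_antisymm ?_ (le_iInf fun σ => ?_)
  · refine (iInf_le _ ⟨meanState V P, meanState_mem V P⟩).trans ?_
    rw [relEntropy_lifted_of_le V ⟨_, meanState_mem V P⟩ (suppLE_meanState V P),
      sum_rel_eq, rel_self, add_zero]
  · by_cases h : SuppLE P V fun _ => (σ : H →L[ℂ] H)
    · rw [relEntropy_lifted_of_le V _ h, sum_rel_eq, EReal.coe_le_coe_iff]
      linarith [rel_meanState_nonneg σ.2 h]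
    · rw [relEntropy_lifted_of_not_le V σ h]
      exact le_top

/-- Weak duality: every channel `V` bounds every term of the supremum. The output `V x` is a test
state in the variational formula for `D_α^♭(W x‖σ)`, for every `σ`, singular or not. -/
theorem mul_sub_chiFlatTwo_le {α : ℝ} (hα : 1 < α) (V W : Channel X H) (R : ℝ) (P : FinProb X) :
    (((α - 1) / α : ℝ) : EReal) * ((R : EReal) - chiFlatTwo α W P) ≤
      condRelEntropy V W P + max 0 ((R : EReal) - holevo V P) := by
  by_cases hVW : SuppLE P V fun x => W x
  swap
  · rw [condRelEntropy_of_not_suppLE hVW, EReal.top_add_of_ne_bot]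
    · exact le_top
    · exact ((EReal.bot_lt_zero).trans_le (le_max_left _ _)).ne'
  rw [condRelEntropy_of_suppLE hVW, holevo_eq_chi]
  set d := ∑ x ∈ P.weights.support, P.weights x * rel (V x : H →L[ℂ] H) (W x) with hd
  have hα1 : 0 < α - 1 := by linarith
  have key : ((chi V P - α / (α - 1) * d : ℝ) : EReal) ≤ chiFlatTwo α W P := by
    refine le_iInf fun σ => ?_
    have hσ0 := states_nonneg σ.2
    by_cases hWσ : SuppLE P W fun _ => (σ : H →L[ℂ] H)
    · have hL := fun x (hx : x ∈ P.weights.support) =>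
        exists_dFlat_eq hα (W x).2 hσ0 (hWσ x hx)
      choose! L hL1 hL2 using hL
      rw [sum_weights_mul_coe P hL1, EReal.coe_le_coe_iff]
      have hVσ : SuppLE P V fun _ => (σ : H →L[ℂ] H) := fun x hx => (hVW x hx).trans (hWσ x hx)
      have h1 : chi V P ≤ ∑ x ∈ P.weights.support, P.weights x * rel (V x : H →L[ℂ] H) σ := by
        rw [sum_rel_eq]
        linarith [rel_meanState_nonneg σ.2 hVσ]
      refine (sub_le_sub_right h1 _).trans ?_
      rw [hd, Finset.mul_sum, ← Finset.sum_sub_distrib]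
      refine Finset.sum_le_sum fun x hx => ?_
      have h2 := (hL2 x hx).2 ⟨(V x : H →L[ℂ] H), ⟨(V x).2, hVW x hx⟩, rfl⟩
      have h3 := mul_le_mul_of_nonneg_left h2 (weights_pos P hx).le
      linarith
    · unfold SuppLE at hWσ
      push Not at hWσ
      obtain ⟨x, hx, hxn⟩ := hWσ
      rw [sum_weights_mul_eq_top P (fun y _ => ?_) hx (dFlat_eq_top hα (W x).2 hσ0 hxn)]
      · exact le_top
      · by_cases hy : LinearMap.range ((W y : H →L[ℂ] H) : H →ₗ[ℂ] H) ≤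
            LinearMap.range ((σ : H →L[ℂ] H) : H →ₗ[ℂ] H)
        · obtain ⟨L, hL, -⟩ := exists_dFlat_eq hα (W y).2 hσ0 hy
          exact .inr ⟨L, hL⟩
        · exact .inl (dFlat_eq_top hα (W y).2 hσ0 hy)
  have hs : 0 ≤ (α - 1) / α := div_nonneg hα1.le (by linarith)
  have hs1 : (α - 1) / α ≤ 1 := by rw [div_le_one (by linarith)]; linarith
  refine (mul_le_mul_of_nonneg_left (EReal.sub_le_sub le_rfl key)
    (EReal.coe_nonneg.mpr hs)).trans ?_
  rw [← EReal.coe_sub, ← EReal.coe_mul, ← EReal.coe_sub, ← EReal.coe_zero,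
    ← EReal.coe_strictMono.monotone.map_max, ← EReal.coe_add,
    EReal.coe_le_coe_iff]
  have h1 : (α - 1) / α * (R - (chi V P - α / (α - 1) * d)) = d + (α - 1) / α * (R - chi V P) := by
    have : α ≠ 0 := by linarith
    field_simp
    ring
  rw [h1]
  gcongr
  rcases le_total 0 (R - chi V P) with h | h
  · exact (mul_le_of_le_one_left h hs1).trans (le_max_right _ _)
  · exact (mul_nonpos_of_nonneg_of_nonpos hs h).trans (le_max_left _ _)

/-! ### The Lagrangian and the minimax theorem -/

lemma tr_pos_of_isStrictlyPositive [Nontrivial H] {T : H →L[ℂ] H} (hT : IsStrictlyPositive T) :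
    0 < tr T := by
  -- `T` is the exponential of a self-adjoint operator
  rw [← CFC.exp_log T hT]
  exact tr_exp_pos IsSelfAdjoint.log

variable (H) in
/-- The positive definite operators of trace less than one. They are the products `s • σ` of a
number `0 < s < 1` and a positive definite state `σ`, and form a convex set. -/
def subStates : Set (H →L[ℂ] H) := {T | IsStrictlyPositive T ∧ tr T < 1}

lemma convex_subStates : Convex ℝ (subStates H) := by
  intro S hS T hT a b ha hb hab
  refine ⟨CFC.concaveOn_log.1 hS.1 hT.1 ha hb hab, ?_⟩
  rw [tr_add, tr_smul, tr_smul]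
  have h1 := hS.2
  have h2 := hT.2
  rcases ha.eq_or_lt with rfl | ha
  · obtain rfl : b = 1 := by linarith
    linarith
  · nlinarith

/-- `Tr T · Tr (τ log (T / Tr T))`, the perspective of `σ ↦ Tr τ log σ`. -/
def persp (τ T : H →L[ℂ] H) : ℝ := tr T * tr (τ * CFC.log ((tr T)⁻¹ • T))

/-- The perspective of a concave function is concave. -/
lemma concaveOn_persp [Nontrivial H] {τ : H →L[ℂ] H} (hτ : 0 ≤ τ) :
    ConcaveOn ℝ (subStates H) (persp τ) := by
  refine ⟨convex_subStates, fun S hS T hT a b ha hb hab => ?_⟩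
  have hs := tr_pos_of_isStrictlyPositive hS.1
  have ht := tr_pos_of_isStrictlyPositive hT.1
  have hU := convex_subStates hS hT ha hb hab
  have hu := tr_pos_of_isStrictlyPositive hU.1
  have hu' : tr (a • S + b • T) = a * tr S + b * tr T := by rw [tr_add, tr_smul, tr_smul]
  -- with `u = a Tr S + b Tr T`, the state `(a S + b T) / u` is the mixture of `S / Tr S` and
  -- `T / Tr T` with weights `a Tr S / u` and `b Tr T / u`
  have h1 := CFC.concaveOn_log.2 (IsStrictlyPositive.smul (inv_pos.mpr hs) hS.1)
    (IsStrictlyPositive.smul (inv_pos.mpr ht) hT.1)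
    (show 0 ≤ (tr (a • S + b • T))⁻¹ * (a * tr S) by positivity)
    (show 0 ≤ (tr (a • S + b • T))⁻¹ * (b * tr T) by positivity) 
    (by rw [← mul_add, ← hu', inv_mul_cancel₀ hu.ne'])
  have e : ∀ u c t : ℝ, t ≠ 0 → u * (c * t) * t⁻¹ = u * c := fun u c t h => by field_simp
  rw [smul_smul, smul_smul, e _ _ _ hs.ne', e _ _ _ ht.ne', ← smul_smul _ a, ← smul_smul _ b,
    ← smul_add] at h1
  have h2 := mul_le_mul_of_nonneg_left (tr_mul_le_tr_mul hτ h1) hu.le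
  rw [mul_add τ, tr_add (τ * _), mul_smul_comm, mul_smul_comm, tr_smul _ (τ * _),
    tr_smul _ (τ * _)] at h2
  refine le_trans (le_of_eq ?_) h2
  simp only [persp, smul_eq_mul]
  field_simp

lemma continuousOn_persp [Nontrivial H] (τ : H →L[ℂ] H) :
    ContinuousOn (persp τ) (subStates H) := by
  have h1 : ContinuousOn (fun T : H →L[ℂ] H => (tr T)⁻¹ • T) (subStates H) :=
    (continuous_tr.continuousOn.inv₀ fun T hT => (tr_pos_of_isStrictlyPositive hT.1).ne').smul
      continuousOn_id
  have h2 : ContinuousOn (fun T : H →L[ℂ] H => CFC.log ((tr T)⁻¹ • T)) (subStates H) := by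
    refine CFC.continuousOn_log.comp h1 fun T hT => ?_
    have := IsStrictlyPositive.smul (inv_pos.mpr (tr_pos_of_isStrictlyPositive hT.1)) hT.1
    exact ⟨nonneg_isSelfAdjoint this.nonneg, this.isUnit⟩
  exact continuous_tr.continuousOn.mul
    (continuous_tr.comp_continuousOn (continuousOn_const.mul h2))

/-- The Lagrangian `∑ x, P(x) (D(V x‖W x) - s D(V x‖σ)) + s R` for `T = s • σ`, written through
entropies. -/
def lagrangian (P : FinProb X) (R : ℝ) (W : Channel X H) (V : P.weights.support → H →L[ℂ] H)
    (T : H →L[ℂ] H) : ℝ :=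
  ∑ x : P.weights.support, P.weights (x : X) *
    ((tr T - 1) * ent (V x) - tr (V x * CFC.log (W (x : X) : H →L[ℂ] H)) + persp (V x) T)
    + tr T * R

lemma lagrangian_eq (R : ℝ) (W : Channel X H) (V : P.weights.support → H →L[ℂ] H) {T : H →L[ℂ] H} :
    lagrangian P R W V T = ∑ x : P.weights.support, P.weights (x : X) * (rel (V x) (W (x : X)) -
      tr T * rel (V x) ((tr T)⁻¹ • T)) + tr T * R := by
  rw [lagrangian]
  congr 1
  refine Finset.sum_congr rfl fun x _ => ?_
  rw [rel_eq, rel_eq, persp]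
  ring

/-- The families of states supported in the outputs of `W`. -/
def supportedFamilies (P : FinProb X) (W : Channel X H) : Set (P.weights.support → H →L[ℂ] H) :=
  Set.univ.pi fun x => statesIn (W (x : X) : H →L[ℂ] H)

lemma continuousOn_lagrangian (R : ℝ) (W : Channel X H) (T : H →L[ℂ] H) :
    ContinuousOn (fun V => lagrangian P R W V T) (supportedFamilies P W) := by
  refine (continuousOn_finsetSum _ fun x _ => continuousOn_const.mul ?_).add continuousOn_const
  have hx : Continuous fun V : P.weights.support → H →L[ℂ] H => V x := continuous_apply x
  refine ContinuousOn.add (ContinuousOn.sub (continuousOn_const.mul ?_) ?_) ?_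
  · exact continuousOn_ent.comp hx.continuousOn fun V hV => states_nonneg (hV x trivial).1
  · exact ((continuous_tr_mul _).comp hx).continuousOn
  · exact continuousOn_const.mul ((continuous_tr_mul _).comp hx).continuousOn

lemma convex_supportedFamilies (W : Channel X H) : Convex ℝ (supportedFamilies P W) :=
  convex_pi fun x _ => convex_statesIn (states_nonneg (W x).2)

lemma convexOn_lagrangian (R : ℝ) (W : Channel X H) {T : H →L[ℂ] H} (hT : T ∈ subStates H) :
    ConvexOn ℝ (supportedFamilies P W) fun V => lagrangian P R W V T := by
  refine ⟨convex_supportedFamilies W, fun V hV U hU a b ha hb hab => ?_⟩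
  have hR : tr T * R = a * (tr T * R) + b * (tr T * R) := by rw [← add_mul, hab, one_mul]
  simp only [lagrangian, smul_eq_mul, mul_add _ (Finset.sum _ _)]
  have : ∀ A B : ℝ, a * A + a * (tr T * R) + (b * B + b * (tr T * R)) = a * A + b * B + tr T * R :=
    fun A B => by linarith
  rw [this, Finset.mul_sum, Finset.mul_sum, ← Finset.sum_add_distrib]
  refine add_le_add_left (Finset.sum_le_sum fun x _ => ?_) _
  have hent := concaveOn_ent.2 (hV x trivial).1 (hU x trivial).1 ha hb hab
  have hlin : ∀ K : H →L[ℂ] H,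
      tr ((a • V + b • U) x * K) = a * tr (V x * K) + b * tr (U x * K) := by
    intro K
    rw [Pi.add_apply, Pi.smul_apply, Pi.smul_apply, add_mul, tr_add, smul_mul_assoc,
      smul_mul_assoc, tr_smul, tr_smul]
  have hw := (weights_pos P x.2).le
  have h1 : (tr T - 1) * ent ((a • V + b • U) x) ≤
      (tr T - 1) * (a * ent (V x) + b * ent (U x)) :=
    mul_le_mul_of_nonpos_left hent (by linarith [hT.2])
  have h2 := mul_le_mul_of_nonneg_left h1 hw
  simp only [persp, hlin]
  linarith

lemma concaveOn_lagrangian [Nontrivial H] (R : ℝ) (W : Channel X H)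
    {V : P.weights.support → H →L[ℂ] H} (hV : V ∈ supportedFamilies P W) :
    ConcaveOn ℝ (subStates H) (lagrangian P R W V) := by
  refine ⟨convex_subStates, fun S hS T hT a b ha hb hab => ?_⟩
  have htr : tr (a • S + b • T) = a * tr S + b * tr T := by rw [tr_add, tr_smul, tr_smul]
  simp only [lagrangian, smul_eq_mul, mul_add _ (Finset.sum _ _), htr]
  have : ∀ A B : ℝ, a * A + a * (tr S * R) + (b * B + b * (tr T * R)) =
    a * A + b * B + (a * tr S + b * tr T) * R := fun A B => by ring
  rw [this, Finset.mul_sum, Finset.mul_sum, ← Finset.sum_add_distrib]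
  refine add_le_add_left (Finset.sum_le_sum fun x _ => ?_) _
  have hp := (concaveOn_persp (states_nonneg (hV x trivial).1)).2 hS hT ha hb hab
  rw [smul_eq_mul, smul_eq_mul] at hp
  have hw := (weights_pos P x.2).le
  obtain rfl : b = 1 - a := by linarith
  have := mul_le_mul_of_nonneg_left hp hw
  linarith

lemma continuousOn_lagrangian_right [Nontrivial H] (R : ℝ) (W : Channel X H)
    (V : P.weights.support → H →L[ℂ] H) : ContinuousOn (lagrangian P R W V) (subStates H) := by
  refine (continuousOn_finsetSum _ fun x _ => continuousOn_const.mul ?_).add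
    (continuous_tr.continuousOn.mul continuousOn_const)
  exact ((((continuous_tr.continuousOn).sub continuousOn_const).mul continuousOn_const).sub
    continuousOn_const).add (continuousOn_persp _)

/-- The two values of the game with payoff the Lagrangian agree, by Sion's minimax theorem. Only the
set of families is compact. -/
theorem iInf_iSup_lagrangian [Nontrivial H] (R : ℝ) (W : Channel X H) :
    (⨅ V ∈ supportedFamilies P W, ⨆ T ∈ subStates H, (lagrangian P R W V T : EReal)) =
      ⨆ T ∈ subStates H, ⨅ V ∈ supportedFamilies P W, (lagrangian P R W V T : EReal) := by
  have hmono : Monotone Real.toEReal := EReal.coe_strictMono.monotone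
  refine Sion.minimax' ?_ (convex_supportedFamilies W) ?_ ?_ ?_ convex_subStates ?_ ?_
  · exact ⟨fun x => W x, fun x _ => self_mem_statesIn (W x).2⟩
  · exact isCompact_univ_pi fun x => isCompact_statesIn (states_nonneg (W x).2)
  · exact fun T hT => (continuous_coe_real_ereal.comp_continuousOn
      (continuousOn_lagrangian R W T)).lowerSemicontinuousOn
  · intro T hT
    have := (convexOn_lagrangian (P := P) R W hT).quasiconvexOn.monotone_comp hmono
    exact this
  · exact fun V hV => (continuous_coe_real_ereal.comp_continuousOn
      (continuousOn_lagrangian_right R W V)).upperSemicontinuousOn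
  · intro V hV
    have := (concaveOn_lagrangian R W hV).quasiconcaveOn.monotone_comp hmono
    exact this

/-! ### Strong duality -/

/-- The value of the Lagrangian at `s • σ`. -/
lemma lagrangian_smul (R : ℝ) (W V : Channel X H) {σ : H →L[ℂ] H} (hσ : tr σ = 1)
    {s : ℝ} (hs : s ≠ 0) :
    lagrangian P R W (fun x => V (x : X)) (s • σ) =
      ∑ x ∈ P.weights.support, P.weights x * rel (V x : H →L[ℂ] H) (W x)
        + s * (R - (chi V P + rel (meanState V P) σ)) := by
  rw [lagrangian_eq, tr_smul, hσ, mul_one, smul_smul, inv_mul_cancel₀ hs, one_smul, ← sum_rel_eq,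
    Finset.sum_coe_sort P.weights.support fun x => P.weights x *
      (rel (V x : H →L[ℂ] H) (W x) - s * rel (V x : H →L[ℂ] H) σ)]
  simp only [mul_sub, Finset.sum_sub_distrib, Finset.mul_sum, mul_left_comm _ s]
  ring

/-- The positive part is approximated from below by the multiples `s * y` with `0 < s < 1`. -/
lemma exists_mul_ge_max (y : ℝ) {η : ℝ} (hη : 0 < η) :
    ∃ s : ℝ, 0 < s ∧ s < 1 ∧ max 0 y - η ≤ s * y := by
  have h0 : 0 < |y| + η := by positivity
  have h1 : 0 < η / (2 * (|y| + η)) := by positivity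
  have h2 : η / (2 * (|y| + η)) < 1 := by
    rw [div_lt_one (by positivity)]
    linarith [abs_nonneg y]
  have h3 : η / (2 * (|y| + η)) * |y| ≤ η := by
    rw [div_mul_eq_mul_div, div_le_iff₀ (by positivity)]
    nlinarith [abs_nonneg y]
  rcases le_total 0 y with hy | hy
  · refine ⟨1 - η / (2 * (|y| + η)), by linarith, by linarith, ?_⟩
    rw [abs_of_nonneg hy] at *
    rw [max_eq_right hy]
    linarith
  · refine ⟨η / (2 * (|y| + η)), h1, h2, ?_⟩
    rw [abs_of_nonpos hy] at *
    rw [max_eq_left hy]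
    linarith

/-- A state is approximated in relative entropy by positive definite states. -/
lemma exists_isStrictlyPositive_rel_le {ρ : H →L[ℂ] H} (hρ : ρ ∈ states H) {η : ℝ} (hη : 0 < η) :
    ∃ σ ∈ states H, IsStrictlyPositive σ ∧ rel ρ σ ≤ η := by
  have hρ0 := states_nonneg hρ
  have hnt := nontrivial_of_states ⟨ρ, hρ⟩
  -- the approximating states are `(ρ + ε) / Tr (ρ + ε)`, with `ε ↘ 0`
  set u : ℝ → ℝ := fun ε => tr (ρ + ε • (1 : H →L[ℂ] H)) with hu
  have hu1 : ∀ ε, u ε = 1 + ε * tr (1 : H →L[ℂ] H) := fun ε => by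
    rw [hu]; simp only [tr_add, tr_smul, states_tr hρ]
  have hulim : Tendsto u (𝓝[>] 0) (𝓝 1) := by
    have : Continuous u := by
      rw [funext hu1]
      fun_prop
    have := this.tendsto 0
    rw [hu1, zero_mul, add_zero] at this
    exact tendsto_nhdsWithin_of_tendsto_nhds this
  have hlim : Tendsto (fun ε => -ent ρ - tr (ρ * CFC.log (ρ + ε • (1 : H →L[ℂ] H)))
      + Real.log (u ε)) (𝓝[>] 0) (𝓝 0) := by
    have h1 := tendsto_tr_mul_log (τ := ρ) hρ0
    rw [mul_kerProj ρ (nonneg_isSelfAdjoint hρ0), tr_zero] at h1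
    have h2 := (h1.const_sub (-ent ρ)).add (hulim.log one_ne_zero)
    simpa [ent] using h2
  obtain ⟨ε, hε, hε0⟩ := ((hlim.eventually_lt_const hη).and self_mem_nhdsWithin).exists
  have hε0 : 0 < ε := hε0
  have hp : IsStrictlyPositive (ρ + ε • (1 : H →L[ℂ] H)) :=
    IsStrictlyPositive.nonneg_add hρ0 (.smul hε0 isStrictlyPositive_one)
  have hup : 0 < u ε := tr_pos_of_isStrictlyPositive hp
  have hq := IsStrictlyPositive.smul (inv_pos.mpr hup) hp
  have hqs : (u ε)⁻¹ • (ρ + ε • (1 : H →L[ℂ] H)) ∈ states H :=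
    mem_states_iff.mpr ⟨hq.nonneg, by rw [tr_smul]; exact inv_mul_cancel₀ hup.ne'⟩
  refine ⟨_, hqs, hq, ?_⟩
  rw [rel_eq, CFC.log_smul' _ (inv_pos.mpr hup) hp, mul_add, tr_add,
    Algebra.algebraMap_eq_smul_one, mul_smul_comm, mul_one, tr_smul, states_tr hρ, Real.log_inv]
  linarith

/-- `F` is at most the upper value of the game with payoff the Lagrangian. -/
theorem exponentF_le_iInf_iSup_lagrangian (R : ℝ) (W : Channel X H) :
    exponentF P R W ≤
      ⨅ V ∈ supportedFamilies P W, ⨆ T ∈ subStates H, (lagrangian P R W V T : EReal) := by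
  classical
  refine le_iInf₂ fun V hV => ?_
  have hV' : ∀ x : P.weights.support, V x ∈ statesIn (W (x : X) : H →L[ℂ] H) :=
    fun x => hV x trivial
  -- outside the support of `P` the outputs of the channel play no role
  obtain ⟨U, hU⟩ : ∃ U : Channel X H, V = fun x : P.weights.support => (U (x : X) : H →L[ℂ] H) :=
    ⟨fun x => if h : x ∈ P.weights.support then ⟨V ⟨x, h⟩, (hV' ⟨x, h⟩).1⟩ else W x, by
      ext1 x; simp only [x.2, dif_pos]⟩
  subst hU
  have hUW : SuppLE P U fun x => W x := fun x hx => (hV' ⟨x, hx⟩).2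
  refine (iInf_le _ U).trans ?_
  rw [condRelEntropy_of_suppLE hUW, holevo_eq_chi, ← EReal.coe_sub, ← EReal.coe_zero,
    ← EReal.coe_strictMono.monotone.map_max, ← EReal.coe_add]
  set d := ∑ x ∈ P.weights.support, P.weights x * rel (U x : H →L[ℂ] H) (W x) with hd
  by_contra! hlt
  obtain ⟨z, hz1, hz2⟩ := EReal.lt_iff_exists_real_btwn.mp hlt
  rw [EReal.coe_lt_coe_iff] at hz2
  -- the gap is shared between the choice of `s` and that of `σ`
  set η := (d + max 0 (R - chi U P) - z) / 2 with hη
  have hη0 : 0 < η := by rw [hη]; linarith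
  obtain ⟨s, hs0, hs1, hs⟩ := exists_mul_ge_max (R - chi U P) hη0
  obtain ⟨σ, hσ, hσp, hσr⟩ := exists_isStrictlyPositive_rel_le (meanState_mem U P) hη0
  have hT : s • σ ∈ subStates H := ⟨.smul hs0 hσp, by rw [tr_smul, states_tr hσ]; linarith⟩
  have h1 := (le_iSup₂ (f := fun T (_ : T ∈ subStates H) =>
    (lagrangian P R W (fun x : P.weights.support => (U (x : X) : H →L[ℂ] H)) T : EReal))
    (s • σ) hT).trans_lt hz1
  rw [EReal.coe_lt_coe_iff, lagrangian_smul R W U (states_tr hσ) hs0.ne', ← hd] at h1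
  have h2 : s * rel (meanState U P) σ ≤ η := by
    rcases le_total 0 (rel (meanState U P) σ) with h | h
    · nlinarith
    · nlinarith
  have h3 : s * (R - (chi U P + rel (meanState U P) σ)) =
    s * (R - chi U P) - s * rel (meanState U P) σ := by ring
  linarith

/-- The lower value of the game is at most the supremum over `α`: for `T = s • σ` the infimum over
the families decouples, and is given by the variational formula for `α = 1 / (1 - s)`. -/
theorem iSup_iInf_lagrangian_le [Nontrivial H] (R : ℝ) (W : Channel X H) :
    (⨆ T ∈ subStates H, ⨅ V ∈ supportedFamilies P W, (lagrangian P R W V T : EReal)) ≤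
      ⨆ (α : ℝ) (_ : 1 < α), (((α - 1) / α : ℝ) : EReal) * ((R : EReal) - chiFlatTwo α W P) := by
  refine iSup₂_le fun T hT => ?_
  have hs0 := tr_pos_of_isStrictlyPositive hT.1
  have hs1 := hT.2
  set s := tr T with hs
  have hσp : IsStrictlyPositive (s⁻¹ • T) := .smul (inv_pos.mpr hs0) hT.1
  have hσ : s⁻¹ • T ∈ states H :=
    mem_states_iff.mpr ⟨hσp.nonneg, by rw [tr_smul]; exact inv_mul_cancel₀ hs0.ne'⟩
  have h1s : 0 < 1 - s := by linarith
  have hα : 1 < (1 - s)⁻¹ := (one_lt_inv₀ h1s).mpr (by linarith)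
  have hαs : ((1 - s)⁻¹ - 1) / (1 - s)⁻¹ = s := by field_simp; ring
  have hαs' : (1 - s)⁻¹ / ((1 - s)⁻¹ - 1) = s⁻¹ := by rw [← hαs, inv_div, hαs]
  have hL := fun x => exists_dFlat_eq hα (W x).2 hσp.nonneg
    (by rw [range_eq_top_of_isStrictlyPositive hσp]; exact le_top)
  choose L hL1 hL2 using hL
  choose τ hτ hτL using fun x => (hL2 x).1
  refine le_trans ?_ (le_iSup₂ (1 - s)⁻¹ hα)
  refine (iInf₂_le (fun x : P.weights.support => τ x)
    fun (x : P.weights.support) _ => hτ x).trans ?_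
  rw [hαs]
  have h1 : chiFlatTwo (1 - s)⁻¹ W P ≤
      ((∑ x ∈ P.weights.support, P.weights x * L x : ℝ) : EReal) := by
    refine (iInf_le _ ⟨_, hσ⟩).trans (le_of_eq ?_)
    exact sum_weights_mul_coe P fun x _ => hL1 x
  refine le_trans ?_ (mul_le_mul_of_nonneg_left (EReal.sub_le_sub le_rfl h1)
    (EReal.coe_nonneg.mpr hs0.le))
  rw [← EReal.coe_sub, ← EReal.coe_mul, EReal.coe_le_coe_iff, lagrangian_eq, ← hs,
    Finset.sum_coe_sort P.weights.support fun x => P.weights x *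
      (rel (τ x) (W x) - s * rel (τ x) (s⁻¹ • T)), mul_sub, Finset.mul_sum]
  have h2 : ∀ x, P.weights x * (rel (τ x) (W x) - s * rel (τ x) (s⁻¹ • T)) =
      - (s * (P.weights x * L x)) := by
    intro x
    rw [← hτL x]
    simp only [hαs']
    field_simp
    ring
  simp only [h2, Finset.sum_neg_distrib]
  linarith

end CQ

end

theorem mainTheorem6 {X H : Type*} [NormedAddCommGroup H] [InnerProductSpace ℂ H]
    [CompleteSpace H] [FiniteDimensional ℂ H]
    (W : CQ.Channel X H) (R : ℝ) (hR : 0 ≤ R) (P : CQ.FinProb X) :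
    CQ.exponentF P R W =
      ⨆ (α : ℝ) (_ : 1 < α),
        (((α - 1) / α : ℝ) : EReal) * ((R : EReal) - CQ.chiFlatTwo α W P) := by
  have := CQ.nontrivial_of_states ⟨_, CQ.meanState_mem W P⟩
  refine le_antisymm ?_ (iSup₂_le fun α hα => le_iInf fun V => CQ.mul_sub_chiFlatTwo_le hα V W R P)
  calc CQ.exponentF P R W
      ≤ ⨅ V ∈ CQ.supportedFamilies P W, ⨆ T ∈ CQ.subStates H, (CQ.lagrangian P R W V T : EReal) :=
        CQ.exponentF_le_iInf_iSup_lagrangian R W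
    _ = ⨆ T ∈ CQ.subStates H, ⨅ V ∈ CQ.supportedFamilies P W, (CQ.lagrangian P R W V T : EReal) :=
        CQ.iInf_iSup_lagrangian R W
    _ ≤ _ := CQ.iSup_iInf_lagrangian_le R W
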